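/- Let $n\ge 5$ and $r\ge 4$. Let $\mathrm{Ni}(A_n,\mathbf C_{3^r})$ be the set of $r$-tuples $\boldsymbol g=(g_1,\dots,g_r)$ of 3-cycles in the alternating group $A_n$ with $g_1g_2\cdots g_r=1$ and $\langle g_1,\dots,g_r\rangle=A_n$. Let the braid group $B_r$, with its standard generators $Q_1,\dots,Q_{r-1}$ (subject to $Q_iQ_j=Q_jQ_i$ for $|i-j|>1$ and $Q_{i+1}Q_iQ_{i+1}=Q_iQ_{i+1}Q_i$), act from the right on $r$-tuples in $A_n$ by $$(\boldsymbol g)Q_i=(g_1,\dots,g_{i-1},\,g_ig_{i+1}g_i^{-1},\,g_i,\,g_{i+2},\dots,g_r).$$ Then for every $\boldsymbol g\in \mathrm{Ni}(A_n,\mathbf C_{3^r})$ there is a $Q\in B_r$ such that $(\boldsymbol g)Q=(g_1',\dots,g_r')$ satisfies $(g_1',g_2')=(g,g^{-1})$ for some 3-cycle $g\in A_n$. -/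

import Mathlib

/-- The relators of Artin's presentation of the braid group on `r` strands. The generator `Q i`
is indexed by the natural numbers `i` with `i + 1 < r` (positions are counted from `0`). -/
inductive BraidRel (r : ℕ) : FreeGroup {i : ℕ // i + 1 < r} → Prop
  | far (i j : {i : ℕ // i + 1 < r}) (h : i.1 + 1 < j.1) :
      BraidRel r (FreeGroup.of i * FreeGroup.of j * (FreeGroup.of j * FreeGroup.of i)⁻¹)
  | adjacent (i j : {i : ℕ // i + 1 < r}) (h : i.1 + 1 = j.1) :
      BraidRel r (FreeGroup.of j * FreeGroup.of i * FreeGroup.of j *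
        (FreeGroup.of i * FreeGroup.of j * FreeGroup.of i)⁻¹)

/-- Artin's braid group `B_r` on `r` strands. -/
abbrev BraidGroup (r : ℕ) : Type := PresentedGroup {w | BraidRel r w}

/-- The generator `Q i` acting on `r`-tuples:
`(…, g i, g (i+1), …) ↦ (…, g i * g (i+1) * (g i)⁻¹, g i, …)`. -/
def braidMove (G : Type*) [Group G] (r : ℕ) (i : {i : ℕ // i + 1 < r}) :
    Equiv.Perm (Fin r → G) where
  toFun g := fun k =>
    if k.1 = i.1 then
      g ⟨i.1, Nat.lt_of_succ_lt i.2⟩ * g ⟨i.1 + 1, i.2⟩ * (g ⟨i.1, Nat.lt_of_succ_lt i.2⟩)⁻¹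
    else if k.1 = i.1 + 1 then g ⟨i.1, Nat.lt_of_succ_lt i.2⟩
    else g k
  invFun g := fun k =>
    if k.1 = i.1 then g ⟨i.1 + 1, i.2⟩
    else if k.1 = i.1 + 1 then
      (g ⟨i.1 + 1, i.2⟩)⁻¹ * g ⟨i.1, Nat.lt_of_succ_lt i.2⟩ * g ⟨i.1 + 1, i.2⟩
    else g k
  left_inv g := by
    funext ⟨k, hk⟩
    by_cases h1 : k = i.1
    · subst h1; simp
    · by_cases h2 : k = i.1 + 1
      · subst h2; simp [mul_assoc]
      · simp [h1, h2]
  right_inv g := by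
    funext ⟨k, hk⟩
    by_cases h1 : k = i.1
    · subst h1; simp [mul_assoc]
    · by_cases h2 : k = i.1 + 1
      · subst h2; simp
      · simp [h1, h2]

theorem braidMove_rel (G : Type*) [Group G] (r : ℕ) :
    ∀ w ∈ {w | BraidRel r w},
      FreeGroup.lift (fun i => MulOpposite.op (braidMove G r i)) w = 1 := by
  rintro w (⟨⟨i, hi⟩, ⟨j, hj⟩, h⟩ | ⟨⟨i, hi⟩, ⟨j, hj⟩, h⟩)
  · simp only [map_mul, map_inv, FreeGroup.lift_apply_of, mul_inv_eq_one]
    apply MulOpposite.unop_injective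
    ext g ⟨k, hk⟩
    simp only [MulOpposite.unop_mul, MulOpposite.unop_op, Equiv.Perm.mul_apply, braidMove,
      Equiv.coe_fn_mk]
    dsimp only at h
    split_ifs <;> first | rfl | omega
  · simp only [map_mul, map_inv, FreeGroup.lift_apply_of, mul_inv_eq_one]
    dsimp only at h
    subst h
    apply MulOpposite.unop_injective
    ext g ⟨k, hk⟩
    simp only [MulOpposite.unop_mul, MulOpposite.unop_op, Equiv.Perm.mul_apply, braidMove,
      Equiv.coe_fn_mk]
    split_ifs <;> first | rfl | omega | (simp [mul_assoc])

/-- The right action of `B_r` on `G ^ r`, as a homomorphism to the opposite of the group of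
permutations of `G ^ r`. -/
def braidHom (G : Type*) [Group G] (r : ℕ) :
    BraidGroup r →* (Equiv.Perm (Fin r → G))ᵐᵒᵖ :=
  PresentedGroup.toGroup (braidMove_rel G r)

/-- `braidAct g Q` is the tuple `(g)Q`, so that `(g)(Q * Q') = ((g)Q)Q'`. -/
def braidAct {G : Type*} [Group G] {r : ℕ} (g : Fin r → G) (Q : BraidGroup r) : Fin r → G :=
  (braidHom G r Q).unop g

/-- The Nielsen class `Ni(G, C)` of a group `G` and a list `C` of `r` conjugacy classes of `G`:
the `r`-tuples that have product one, generate `G`, and have their entries in the classes of `C`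
in some order, with multiplicity. -/
def nielsenClass (G : Type*) [Group G] {r : ℕ} (C : Fin r → Set G) : Set (Fin r → G) :=
  {g | (List.ofFn g).prod = 1 ∧
    (∃ σ : Equiv.Perm (Fin r), ∀ i, g i ∈ C (σ i)) ∧
    Subgroup.closure (Set.range g) = ⊤}

/-- The set of 3-cycles in `A_n`; a single conjugacy class of `A_n` for `n ≥ 5`. -/
def threeCycleClass (n : ℕ) : Set (alternatingGroup (Fin n)) :=
  {g | (g : Equiv.Perm (Fin n)).IsThreeCycle}

theorem threeCycleClass_eq_carrier (n : ℕ) (hn : 5 ≤ n) (g : alternatingGroup (Fin n))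
    (hg : g ∈ threeCycleClass n) : threeCycleClass n = (ConjClasses.mk g).carrier := by
  ext h
  rw [ConjClasses.mem_carrier_iff_mk_eq, ConjClasses.mk_eq_mk_iff_isConj]
  constructor
  · intro hh
    exact alternatingGroup.isThreeCycle_isConj (by simpa using hn) hh hg
  · intro hh
    obtain ⟨c, hc⟩ := isConj_iff.1 hh
    have hc' : (c : Equiv.Perm (Fin n)) * h * (c : Equiv.Perm (Fin n))⁻¹ = g := by
      rw [← hc]; rfl
    have hg' : (g : Equiv.Perm (Fin n)).cycleType = {3} := hg
    rw [← hc', Equiv.Perm.cycleType_conj] at hg'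
    exact hg'

/-- The pair `(a, b)` of elements of `A_n` has the form `(c, c⁻¹)` with `c` a 3-cycle. -/
def IsInversePair {n : ℕ} (a b : alternatingGroup (Fin n)) : Prop :=
  a ∈ threeCycleClass n ∧ b = a⁻¹

/-! Tuples become lists of 3-cycles moving only points of a set `S` with at least five elements,
with product one and leaving no nonempty proper subset of `S` invariant. Induction on `S` shows that
the braid orbit of such a list contains two neighbours `g, g⁻¹`. A pair with product one slides
through the other entries unchanged, so it can be brought to the front.

Pick `n` in `S` and braid so that as few entries as possible move `n`, gathered in a block. By
minimality every braiding of the block consists of entries moving `n`. If no inverse pair occurs,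
comparing neighbours leaves two shapes (`exists_block`): equal entries `a, …, a`, or a pair `(n x
y), (n y w)`.

Equal entries: the product of the block fixes `n`, so three divides their number, which is positive
by connectedness. A triple `a, a, a` has product one, hence slides freely and can be conjugated by
any other entry. This freedom produces an inverse pair (`hasInversePair_of_cube`).

A pair: its product `(x y w)` no longer moves `n`, and merging preserves connectedness on the
remaining points. For six or more points, induction gives an inverse pair for the merged list.
Splitting the merged entry again (`BraidEquiv.exists_split`) keeps that pair or yields the triangle
`(n x y), (n y w), (w y x)`, treated in `hasInversePair_of_triangle`. For five points, the block
analysis is repeated at the point outside `{n, x, y, w}` (`hasInversePair_of_card_eq_five`).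

The local configurations are settled by explicit braid words on at most six labels, checked by
computation. -/

/-! ### Braid equivalence of lists in a group -/

section BraidLists

variable {G : Type*} [Group G]

/-- An elementary braid move, or its inverse, on a pair of neighbours in a list. -/
inductive BraidStep : List G → List G → Prop
  | fwd (l : List G) (a b : G) (m : List G) :
      BraidStep (l ++ a :: b :: m) (l ++ (a * b * a⁻¹) :: a :: m)
  | bwd (l : List G) (a b : G) (m : List G) :
      BraidStep (l ++ a :: b :: m) (l ++ b :: (b⁻¹ * a * b) :: m)

/-- Braid equivalence of lists. -/
def BraidEquiv : List G → List G → Prop := Relation.ReflTransGen BraidStep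

theorem BraidStep.symm {l m : List G} (h : BraidStep l m) : BraidStep m l := by
  cases h with
  | fwd l a b m =>
    have := BraidStep.bwd l (a * b * a⁻¹) a m
    simpa [mul_assoc] using this
  | bwd l a b m =>
    have := BraidStep.fwd l b (b⁻¹ * a * b) m
    simpa [mul_assoc] using this

theorem BraidStep.append {l m : List G} (h : BraidStep l m) (u v : List G) :
    BraidStep (u ++ l ++ v) (u ++ m ++ v) := by
  cases h with
  | fwd l a b m => simpa using BraidStep.fwd (u ++ l) a b (m ++ v)
  | bwd l a b m => simpa using BraidStep.bwd (u ++ l) a b (m ++ v)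

namespace BraidEquiv

theorem refl (l : List G) : BraidEquiv l l := Relation.ReflTransGen.refl

theorem trans {l m k : List G} (h : BraidEquiv l m) (h' : BraidEquiv m k) : BraidEquiv l k :=
  Relation.ReflTransGen.trans h h'

theorem symm {l m : List G} (h : BraidEquiv l m) : BraidEquiv m l := by
  induction h with
  | refl => exact refl _
  | tail _ h2 ih => exact trans (Relation.ReflTransGen.single h2.symm) ih

theorem append {l m : List G} (h : BraidEquiv l m) (u v : List G) :
    BraidEquiv (u ++ l ++ v) (u ++ m ++ v) := by
  induction h with
  | refl => exact refl _
  | tail _ h2 ih => exact ih.trans (Relation.ReflTransGen.single (h2.append u v))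

theorem append_left {l m : List G} (h : BraidEquiv l m) (u : List G) :
    BraidEquiv (u ++ l) (u ++ m) := by simpa using h.append u []

theorem append_right {l m : List G} (h : BraidEquiv l m) (v : List G) :
    BraidEquiv (l ++ v) (m ++ v) := by simpa using h.append [] v

theorem cons {l m : List G} (h : BraidEquiv l m) (a : G) :
    BraidEquiv (a :: l) (a :: m) := h.append_left [a]

theorem fwd (l : List G) (a b : G) (m : List G) :
    BraidEquiv (l ++ a :: b :: m) (l ++ (a * b * a⁻¹) :: a :: m) :=
  Relation.ReflTransGen.single (.fwd l a b m)

theorem bwd (l : List G) (a b : G) (m : List G) :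
    BraidEquiv (l ++ a :: b :: m) (l ++ b :: (b⁻¹ * a * b) :: m) :=
  Relation.ReflTransGen.single (.bwd l a b m)

theorem length_eq {l m : List G} (h : BraidEquiv l m) : l.length = m.length := by
  induction h with
  | refl => rfl
  | tail _ h2 ih => rw [ih]; cases h2 <;> simp

theorem prod_eq {l m : List G} (h : BraidEquiv l m) : l.prod = m.prod := by
  induction h with
  | refl => rfl
  | tail _ h2 ih => rw [ih]; cases h2 <;> simp [mul_assoc]

/-- A move only forms products and inverses of entries. Taking `H` to be the stabilizer of a point
or of a set transports fixed points, supports and connectedness along braids. -/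
theorem forall_mem_subgroup {l m : List G} (h : BraidEquiv l m) (H : Subgroup G)
    (hl : ∀ g ∈ l, g ∈ H) : ∀ g ∈ m, g ∈ H := by
  induction h with
  | refl => exact hl
  | tail _ h2 ih =>
    cases h2 with
    | fwd l a b m =>
      have ha : a ∈ H := ih a (by simp)
      have hb : b ∈ H := ih b (by simp)
      intro g hg
      simp only [List.mem_append, List.mem_cons] at hg
      rcases hg with hg | rfl | rfl | hg
      · exact ih g (by simp [hg])
      · exact H.mul_mem (H.mul_mem ha hb) (H.inv_mem ha)
      · exact ha
      · exact ih g (by simp [hg])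
    | bwd l a b m =>
      have ha : a ∈ H := ih a (by simp)
      have hb : b ∈ H := ih b (by simp)
      intro g hg
      simp only [List.mem_append, List.mem_cons] at hg
      rcases hg with hg | rfl | rfl | hg
      · exact ih g (by simp [hg])
      · exact hb
      · exact H.mul_mem (H.mul_mem (H.inv_mem hb) ha) hb
      · exact ih g (by simp [hg])

theorem forall_mem_of_conj {l m : List G} (h : BraidEquiv l m) {P : G → Prop}
    (hP : ∀ a b, P b → P (a * b * a⁻¹)) (hl : ∀ g ∈ l, P g) : ∀ g ∈ m, P g := by
  induction h with
  | refl => exact hl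
  | tail _ h2 ih =>
    cases h2 with
    | fwd l a b m =>
      intro g hg
      simp only [List.mem_append, List.mem_cons] at hg
      rcases hg with hg | rfl | rfl | hg
      · exact ih g (by simp [hg])
      · exact hP _ _ (ih b (by simp))
      · exact ih _ (by simp)
      · exact ih g (by simp [hg])
    | bwd l a b m =>
      intro g hg
      simp only [List.mem_append, List.mem_cons] at hg
      rcases hg with hg | rfl | rfl | hg
      · exact ih g (by simp [hg])
      · exact ih _ (by simp)
      · simpa using hP b⁻¹ _ (ih a (by simp))
      · exact ih g (by simp [hg])

/-- An entry moves to the left end unchanged. -/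
theorem move_left (u : List G) (a : G) :
    BraidEquiv (u ++ [a]) (a :: u.map (fun x => a⁻¹ * x * a)) := by
  induction u with
  | nil => exact refl _
  | cons b u ih => exact (ih.cons b).trans (bwd [] b a _)

/-- An entry moves to the right end unchanged. -/
theorem move_right (a : G) (u : List G) :
    BraidEquiv (a :: u) (u.map (fun x => a * x * a⁻¹) ++ [a]) := by
  induction u with
  | nil => exact refl _
  | cons b u ih => exact (fwd [] a b u).trans (ih.cons _)

/-- A block moves to the left unchanged. -/
theorem move_block_left (u v : List G) :
    BraidEquiv (u ++ v) (v ++ u.map (fun x => v.prod⁻¹ * x * v.prod)) := by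
  induction v generalizing u with
  | nil => simpa using refl u
  | cons a v ih =>
    have h1 := (move_left u a).append_right v
    have h2 := (ih (u.map (fun x => a⁻¹ * x * a))).cons a
    have h3 := h1.trans h2
    simpa [Function.comp_def, mul_assoc] using h3

/-- A block with product one can be moved anywhere without changing the other entries. -/
theorem swap_of_prod_eq_one (u v : List G) (hv : v.prod = 1) :
    BraidEquiv (u ++ v) (v ++ u) := by
  simpa [hv] using move_block_left u v

/-- Replacing an entry by a pair with the same product is compatible with braiding. -/
theorem exists_split {l m : List G} (h : BraidEquiv l m) {u v : List G} {a b : G}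
    (hl : l = u ++ (a * b) :: v) :
    ∃ (u' v' : List G) (p : G), m = u' ++ (p * (a * b) * p⁻¹) :: v' ∧
      BraidEquiv (u ++ a :: b :: v) (u' ++ (p * a * p⁻¹) :: (p * b * p⁻¹) :: v') := by
  induction h with
  | refl => exact ⟨u, v, 1, by simpa using hl, by simpa using refl _⟩
  | @tail m k _ h2 ih =>
    obtain ⟨u', v', p, hm, hbr⟩ := ih
    clear hl
    set a' := p * a * p⁻¹ with ha'
    set b' := p * b * p⁻¹ with hb'
    have hab : p * (a * b) * p⁻¹ = a' * b' := by simp [ha', hb', mul_assoc]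
    rw [hab] at hm
    -- It suffices to follow one elementary move, since successive conjugators multiply.
    suffices H : ∃ (u'' v'' : List G) (s : G), k = u'' ++ (s * (a' * b') * s⁻¹) :: v'' ∧
        BraidEquiv (u' ++ a' :: b' :: v') (u'' ++ (s * a' * s⁻¹) :: (s * b' * s⁻¹) :: v'') by
      obtain ⟨u'', v'', s, h1, h3⟩ := H
      refine ⟨u'', v'', s * p, ?_, ?_⟩
      · rw [h1, ← hab]; simp [mul_assoc]
      · have := hbr.trans h3
        simpa [ha', hb', mul_assoc] using this
    clear_value a' b'
    clear hbr ha' hb' hab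
    cases h2 with
    | fwd l x y r =>
      -- The list `t` locates the tracked entry relative to the moved pair `x, y`: it is `x`, it is
      -- `y`, or it lies outside. When it takes part, one move of the product becomes two moves of
      -- its factors.
      rw [List.append_eq_append_iff] at hm
      rcases hm with ⟨t, rfl, ht⟩ | ⟨t, rfl, ht⟩
      · match t, ht with
        | [], ht =>
          simp only [List.nil_append, List.cons.injEq] at ht
          obtain ⟨rfl, rfl⟩ := ht
          refine ⟨l ++ [a' * b' * y * (a' * b')⁻¹], r, 1, by simp, ?_⟩
          have h1 := (fwd (l ++ [a']) b' y r).trans (by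
            simpa using fwd l a' (b' * y * b'⁻¹) (b' :: r))
          simpa [mul_assoc] using h1
        | [z], ht =>
          simp only [List.cons_append, List.nil_append, List.cons.injEq] at ht
          obtain ⟨rfl, rfl, rfl⟩ := ht
          refine ⟨l, x :: r, x, by simp, ?_⟩
          have h1 := (fwd l x a' (b' :: r)).trans (by
            simpa using fwd (l ++ [x * a' * x⁻¹]) x b' r)
          simpa [mul_assoc] using h1
        | z :: z' :: t, ht =>
          simp only [List.cons_append, List.cons.injEq] at ht
          obtain ⟨rfl, rfl, rfl⟩ := ht
          refine ⟨l ++ (x * y * x⁻¹) :: x :: t, v', 1, by simp, ?_⟩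
          simpa using fwd l x y (t ++ a' :: b' :: v')
      · match t, ht with
        | [], ht =>
          simp only [List.nil_append, List.cons.injEq] at ht
          obtain ⟨rfl, rfl⟩ := ht
          refine ⟨u' ++ [a' * b' * y * (a' * b')⁻¹], r, 1, by simp, ?_⟩
          have h1 := (fwd (u' ++ [a']) b' y r).trans (by
            simpa using fwd u' a' (b' * y * b'⁻¹) (b' :: r))
          simpa [mul_assoc] using h1
        | z :: t, ht =>
          simp only [List.cons_append, List.cons.injEq] at ht
          obtain ⟨rfl, rfl⟩ := ht
          refine ⟨u', t ++ (x * y * x⁻¹) :: x :: r, 1, by simp, ?_⟩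
          simpa using fwd (u' ++ a' :: b' :: t) x y r
    | bwd l x y r =>
      rw [List.append_eq_append_iff] at hm
      rcases hm with ⟨t, rfl, ht⟩ | ⟨t, rfl, ht⟩
      · match t, ht with
        | [], ht =>
          simp only [List.nil_append, List.cons.injEq] at ht
          obtain ⟨rfl, rfl⟩ := ht
          refine ⟨l ++ [y], r, y⁻¹, by simp, ?_⟩
          have h1 := (bwd (l ++ [a']) b' y r).trans (by
            simpa using bwd l a' y ((y⁻¹ * b' * y) :: r))
          simpa [mul_assoc] using h1
        | [z], ht =>
          simp only [List.cons_append, List.nil_append, List.cons.injEq] at ht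
          obtain ⟨rfl, rfl, rfl⟩ := ht
          refine ⟨l, ((a' * b')⁻¹ * x * (a' * b')) :: r, 1, by simp, ?_⟩
          have h1 := (bwd l x a' (b' :: r)).trans (by
            simpa using bwd (l ++ [a']) (a'⁻¹ * x * a') b' r)
          simpa [mul_assoc] using h1
        | z :: z' :: t, ht =>
          simp only [List.cons_append, List.cons.injEq] at ht
          obtain ⟨rfl, rfl, rfl⟩ := ht
          refine ⟨l ++ y :: (y⁻¹ * x * y) :: t, v', 1, by simp, ?_⟩
          simpa using bwd l x y (t ++ a' :: b' :: v')
      · match t, ht with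
        | [], ht =>
          simp only [List.nil_append, List.cons.injEq] at ht
          obtain ⟨rfl, rfl⟩ := ht
          refine ⟨u' ++ [y], r, y⁻¹, by simp, ?_⟩
          have h1 := (bwd (u' ++ [a']) b' y r).trans (by
            simpa using bwd u' a' y ((y⁻¹ * b' * y) :: r))
          simpa [mul_assoc] using h1
        | z :: t, ht =>
          simp only [List.cons_append, List.cons.injEq] at ht
          obtain ⟨rfl, rfl⟩ := ht
          refine ⟨u', t ++ y :: (y⁻¹ * x * y) :: r, 1, by simp, ?_⟩
          simpa using bwd (u' ++ a' :: b' :: t) x y r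

/-- Braid equivalence of lists is realized by the action of the braid group. -/
theorem exists_braidAct {H : Type*} [Group H] (φ : H →* G) {r : ℕ} {l m : List G}
    (h : BraidEquiv l m) (g : Fin r → H) (hl : l = List.ofFn (fun i => φ (g i))) :
    ∃ Q : BraidGroup r, m = List.ofFn (fun i => φ (braidAct g Q i)) := by
  induction h with
  | refl => exact ⟨1, by simpa [braidAct] using hl⟩
  | @tail m k _ h2 ih =>
    obtain ⟨Q, hQ⟩ := ih
    have act_mul (Q' : BraidGroup r) : braidAct g (Q * Q') = braidAct (braidAct g Q) Q' := by
      simp [braidAct]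
    have act_of (i : {i : ℕ // i + 1 < r}) (f : Fin r → H) :
        braidAct f (PresentedGroup.of i) = braidMove H r i f := by
      simp [braidAct, braidHom]
    have act_of_inv (i : {i : ℕ // i + 1 < r}) (f : Fin r → H) :
        braidAct f (PresentedGroup.of i)⁻¹ = (braidMove H r i)⁻¹ f := by
      simp [braidAct, braidHom]
    suffices H : ∃ Q' : BraidGroup r,
        k = List.ofFn (fun i => φ (braidAct (braidAct g Q) Q' i)) by
      obtain ⟨Q', h'⟩ := H
      exact ⟨Q * Q', by rw [h', act_mul]⟩
    generalize braidAct g Q = f at hQ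
    cases h2 with
    | fwd l a b v =>
      have hlen := congrArg List.length hQ
      simp only [List.length_append, List.length_cons, List.length_ofFn] at hlen
      -- Positions count from zero, so the moved pair starts at position `l.length`.
      refine ⟨PresentedGroup.of ⟨l.length, by omega⟩, ?_⟩
      rw [act_of]
      apply List.ext_getElem
      · simp; omega
      intro i h1 h2
      have e (j : ℕ) (hj : j < r) : φ (f ⟨j, hj⟩) = (l ++ a :: b :: v)[j]'(by simp; omega) := by
        simp only [hQ]; simp
      have ea := e l.length (by omega)
      have eb := e (l.length + 1) (by omega)
      simp only [List.length_ofFn] at h2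
      have ei := e i h2
      simp only [List.getElem_ofFn, braidMove, Equiv.coe_fn_mk]
      split_ifs with c1 c2
      · subst c1; simp at ea eb; simp [ea, eb]
      · subst c2; simp at ea; simp [ea]
      · rw [ei]
        rcases Nat.lt_or_ge i l.length with c | c
        · rw [List.getElem_append_left c, List.getElem_append_left c]
        · rw [List.getElem_append_right c, List.getElem_append_right c]
          obtain ⟨t, ht⟩ : ∃ t, i - l.length = t + 2 := ⟨i - l.length - 2, by omega⟩
          simp [ht]
    | bwd l a b v =>
      have hlen := congrArg List.length hQ
      simp only [List.length_append, List.length_cons, List.length_ofFn] at hlen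
      refine ⟨(PresentedGroup.of ⟨l.length, by omega⟩)⁻¹, ?_⟩
      rw [act_of_inv]
      apply List.ext_getElem
      · simp; omega
      intro i h1 h2
      have e (j : ℕ) (hj : j < r) : φ (f ⟨j, hj⟩) = (l ++ a :: b :: v)[j]'(by simp; omega) := by
        simp only [hQ]; simp
      have ea := e l.length (by omega)
      have eb := e (l.length + 1) (by omega)
      simp only [List.length_ofFn] at h2
      have ei := e i h2
      simp only [List.getElem_ofFn, braidMove, Equiv.Perm.inv_def, Equiv.coe_fn_symm_mk]
      split_ifs with c1 c2
      · subst c1; simp at eb; simp [eb]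
      · subst c2; simp at ea eb; simp [ea, eb]
      · rw [ei]
        rcases Nat.lt_or_ge i l.length with c | c
        · rw [List.getElem_append_left c, List.getElem_append_left c]
        · rw [List.getElem_append_right c, List.getElem_append_right c]
          obtain ⟨t, ht⟩ : ∃ t, i - l.length = t + 2 := ⟨i - l.length - 2, by omega⟩
          simp [ht]

end BraidEquiv

/-- The list is braid equivalent to one with two neighbouring entries `g, g⁻¹`. -/
def HasInversePair (l : List G) : Prop :=
  ∃ (u : List G) (g : G) (v : List G), BraidEquiv l (u ++ g :: g⁻¹ :: v)

theorem HasInversePair.of_braidEquiv {l m : List G} (h : BraidEquiv l m) (hm : HasInversePair m) :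
    HasInversePair l := by
  obtain ⟨u, g, v, h'⟩ := hm
  exact ⟨u, g, v, h.trans h'⟩

theorem HasInversePair.append {l : List G} (h : HasInversePair l) (u v : List G) :
    HasInversePair (u ++ l ++ v) := by
  obtain ⟨u', g, v', h'⟩ := h
  exact ⟨u ++ u', g, v' ++ v, by simpa using h'.append u v⟩

/-- An inverse pair can be moved to the front. -/
theorem HasInversePair.exists_front {l : List G} (h : HasInversePair l) :
    ∃ (g : G) (v : List G), BraidEquiv l (g :: g⁻¹ :: v) := by
  obtain ⟨u, g, v, h'⟩ := h
  refine ⟨g, u ++ v, h'.trans ?_⟩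
  have := (BraidEquiv.swap_of_prod_eq_one u [g, g⁻¹] (by simp)).append_right v
  simpa using this

end BraidLists

/-! ### Three-cycles as explicit permutations -/

section ThreeCycles

variable {α : Type*} [DecidableEq α]

open Equiv

/-- The permutation `x ↦ y ↦ z ↦ x`. -/
def cyc (x y z : α) : Perm α := swap x y * swap y z

theorem mul_cyc_mul_inv (g : Perm α) (x y z : α) :
    g * cyc x y z * g⁻¹ = cyc (g x) (g y) (g z) := by
  simp only [cyc, swap_apply_apply]
  group

theorem cyc_apply {x y z : α} (hxy : x ≠ y) (hxz : x ≠ z) (hyz : y ≠ z) (p : α) :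
    cyc x y z p = if p = x then y else if p = y then z else if p = z then x else p := by
  simp only [cyc, Perm.mul_apply, swap_apply_def]
  split_ifs <;> simp_all

theorem cyc_rotate {x y z : α} (hxy : x ≠ y) (hxz : x ≠ z) (hyz : y ≠ z) :
    cyc x y z = cyc y z x := by
  ext p
  rw [cyc_apply hxy hxz hyz, cyc_apply hyz hxy.symm hxz.symm]
  split_ifs <;> simp_all

theorem inv_cyc {x y z : α} : (cyc x y z)⁻¹ = cyc z y x := by
  simp [cyc, swap_comm]

/-- This is the merging identity: two 3-cycles through `n` multiply to one that fixes `n`. -/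
theorem cyc_mul_cyc {n x y w : α} (hnx : n ≠ x) (hny : n ≠ y) (hnw : n ≠ w) (hxy : x ≠ y)
    (hxw : x ≠ w) (hyw : y ≠ w) : cyc n x y * cyc n y w = cyc x y w := by
  ext p
  rw [Perm.mul_apply, cyc_apply hny hnw hyw, cyc_apply hnx hny hxy, cyc_apply hxy hxw hyw]
  split_ifs <;> simp_all

theorem isThreeCycle_cyc [Fintype α] {x y z : α} (hxy : x ≠ y) (hxz : x ≠ z) (hyz : y ≠ z) :
    (cyc x y z).IsThreeCycle := by
  have := Perm.isThreeCycle_swap_mul_swap_same hxy.symm hyz hxz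
  rwa [swap_comm y x] at this

section

variable [Fintype α] {g : Perm α}

theorem isThreeCycle_pow_three (hg : g.IsThreeCycle) (n : α) : g (g (g n)) = n := by
  have h : g ^ 3 = 1 := by rw [← hg.orderOf]; exact pow_orderOf_eq_one g
  simpa [pow_succ] using congrArg (fun f : Perm α => f n) h

theorem isThreeCycle_inv_apply (hg : g.IsThreeCycle) (n : α) : g⁻¹ n = g (g n) := by
  rw [Perm.inv_eq_iff_eq, isThreeCycle_pow_three hg]

theorem isThreeCycle_apply_apply_ne (hg : g.IsThreeCycle) {n : α} (hn : g n ≠ n) :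
    g (g n) ≠ n := fun h => hn (by
  have := isThreeCycle_pow_three hg n
  rwa [h] at this)

theorem isThreeCycle_eq_cyc (hg : g.IsThreeCycle) {n : α} (hn : g n ≠ n) :
    g = cyc n (g n) (g (g n)) := by
  have h1 : g n ≠ g (g n) := fun h => hn (g.injective h).symm
  have h2 := (isThreeCycle_apply_apply_ne hg hn).symm
  -- The orbit of `n` already has three points, so it exhausts the support.
  have hs : ({n, g n, g (g n)} : Finset α) = g.support := by
    apply Finset.eq_of_subset_of_card_le
    · intro p
      simp only [Finset.mem_insert, Finset.mem_singleton, Perm.mem_support]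
      rintro (rfl | rfl | rfl)
      · exact hn
      · exact h1.symm
      · rwa [isThreeCycle_pow_three hg]
    · rw [hg.card_support, Finset.card_eq_three.2 ⟨n, g n, g (g n), hn.symm, h2, h1, rfl⟩]
  ext p
  rw [cyc_apply hn.symm h2 h1]
  split_ifs with c1 c2 c3
  · rw [c1]
  · rw [c2]
  · rw [c3, isThreeCycle_pow_three hg]
  · by_contra h
    have : p ∈ g.support := Perm.mem_support.2 h
    rw [← hs] at this
    simp only [Finset.mem_insert, Finset.mem_singleton] at this
    tauto

theorem exists_eq_cyc (hg : g.IsThreeCycle) {n : α} (hn : g n ≠ n) :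
    ∃ x y, n ≠ x ∧ n ≠ y ∧ x ≠ y ∧ g = cyc n x y :=
  ⟨g n, g (g n), hn.symm, (isThreeCycle_apply_apply_ne hg hn).symm,
    fun h => hn (g.injective h).symm, isThreeCycle_eq_cyc hg hn⟩

theorem isThreeCycle_ext {h : Perm α} (hg : g.IsThreeCycle) (hh : h.IsThreeCycle) {n : α}
    (hgn : g n ≠ n) (h1 : g n = h n) (h2 : g (g n) = h (h n)) : g = h := by
  rw [isThreeCycle_eq_cyc hg hgn, isThreeCycle_eq_cyc hh (n := n) (h1 ▸ hgn), h2, h1]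

theorem isThreeCycle_eq_or (hg : g.IsThreeCycle) {n p : α} (hn : g n ≠ n) (hp : g p ≠ p) :
    p = n ∨ p = g n ∨ p = g (g n) := by
  by_contra hne
  push Not at hne
  apply hp
  have e := isThreeCycle_eq_cyc hg hn
  have h1 : g n ≠ g (g n) := fun h => hn (g.injective h).symm
  rw [e, cyc_apply hn.symm (isThreeCycle_apply_apply_ne hg hn).symm h1]
  simp [hne]

theorem isThreeCycle_conj (hg : g.IsThreeCycle) (h : Perm α) : (h * g * h⁻¹).IsThreeCycle := by
  have := Perm.cycleType_conj (σ := g) (τ := h)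
  exact this.trans hg

end

end ThreeCycles

/-! ### Computable verification of braid words on labels -/

section Words

variable {m : ℕ}

/-- The action of the 3-cycle encoded by a triple. -/
def tripleAct (t : Fin m × Fin m × Fin m) (p : Fin m) : Fin m :=
  if p = t.1 then t.2.1 else if p = t.2.1 then t.2.2 else if p = t.2.2 then t.1 else p

/-- Conjugation of the 3-cycle encoded by `s` by the one encoded by `t`. -/
def tripleConj (t s : Fin m × Fin m × Fin m) : Fin m × Fin m × Fin m :=
  (tripleAct t s.1, tripleAct t s.2.1, tripleAct t s.2.2)

/-- Whether a triple has distinct entries. -/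
def tripleValid (t : Fin m × Fin m × Fin m) : Bool :=
  t.1 ≠ t.2.1 && t.1 ≠ t.2.2 && t.2.1 ≠ t.2.2

/-- A braid move on a list of encoded 3-cycles. -/
def tripleStep (back : Bool) :
    ℕ → List (Fin m × Fin m × Fin m) → List (Fin m × Fin m × Fin m)
  | 0, a :: b :: l =>
    if back then b :: tripleConj (b.2.2, b.2.1, b.1) a :: l else tripleConj a b :: a :: l
  | i + 1, a :: l => a :: tripleStep back i l
  -- A position without two entries leaves the list unchanged.
  | _, l => l

/-- Whether two neighbouring encoded 3-cycles are inverse to each other. -/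
def tripleInverse : List (Fin m × Fin m × Fin m) → Bool
  | a :: b :: l =>
    b = (a.2.2, a.2.1, a.1) || b = (a.2.1, a.1, a.2.2) || b = (a.1, a.2.2, a.2.1) ||
      tripleInverse (b :: l)
  | _ => false

/-- Whether a braid word leads to two neighbouring inverse 3-cycles. -/
def tripleCheck : List (Bool × ℕ) → List (Fin m × Fin m × Fin m) → Bool
  | [], l => l.all tripleValid && tripleInverse l
  -- Validity is rechecked before each move, because `tripleConj` models conjugation only by a
  -- triple with distinct entries.
  | (b, i) :: w, l => l.all tripleValid && tripleCheck w (tripleStep b i l)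

variable {α : Type*} [DecidableEq α]

open Equiv

/-- The 3-cycle encoded by a triple of labels. -/
def tripleCyc (f : Fin m → α) (t : Fin m × Fin m × Fin m) : Perm α :=
  cyc (f t.1) (f t.2.1) (f t.2.2)

variable {f : Fin m → α}

theorem tripleCyc_apply (hf : f.Injective) {t : Fin m × Fin m × Fin m} (ht : tripleValid t) (p : Fin m) :
    tripleCyc f t (f p) = f (tripleAct t p) := by
  simp only [tripleValid, ne_eq, Bool.and_eq_true, decide_eq_true_eq] at ht
  rw [tripleCyc, cyc_apply (hf.ne ht.1.1) (hf.ne ht.1.2) (hf.ne ht.2)]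
  simp only [hf.eq_iff, tripleAct]
  split_ifs <;> rfl

theorem tripleCyc_conj (hf : f.Injective) {t : Fin m × Fin m × Fin m} (ht : tripleValid t)
    (s : Fin m × Fin m × Fin m) :
    tripleCyc f (tripleConj t s) = tripleCyc f t * tripleCyc f s * (tripleCyc f t)⁻¹ := by
  rw [tripleCyc.eq_def f s, mul_cyc_mul_inv, tripleCyc_apply hf ht, tripleCyc_apply hf ht,
    tripleCyc_apply hf ht]
  rfl

theorem braidEquiv_tripleStep (hf : f.Injective) (back : Bool) (i : ℕ) (l : List (Fin m × Fin m × Fin m))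
    (hl : ∀ t ∈ l, tripleValid t) :
    BraidEquiv (l.map (tripleCyc f)) ((tripleStep back i l).map (tripleCyc f)) := by
  induction i generalizing l with
  | zero =>
    match l, hl with
    | [], _ => exact .refl _
    | [a], _ => exact .refl _
    | a :: b :: l, hl =>
      have ha : tripleValid a := hl a (by simp)
      have hb : tripleValid (b.2.2, b.2.1, b.1) := by
        have := hl b (by simp)
        simp only [tripleValid, ne_eq, Bool.and_eq_true, decide_eq_true_eq] at this ⊢
        exact ⟨⟨Ne.symm this.2, Ne.symm this.1.2⟩, Ne.symm this.1.1⟩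
      cases back with
      | false =>
        have := BraidEquiv.fwd [] (tripleCyc f a) (tripleCyc f b) (l.map (tripleCyc f))
        simpa [tripleStep, tripleCyc_conj hf ha] using this
      | true =>
        have := BraidEquiv.bwd [] (tripleCyc f a) (tripleCyc f b) (l.map (tripleCyc f))
        have e : (tripleCyc f b)⁻¹ = tripleCyc f (b.2.2, b.2.1, b.1) := inv_cyc
        have e' : (tripleCyc f (b.2.2, b.2.1, b.1))⁻¹ = tripleCyc f b := inv_cyc
        simpa [tripleStep, tripleCyc_conj hf hb, e, e'] using this
  | succ i ih =>
    match l, hl with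
    | [], _ => exact .refl _
    | a :: l, hl => exact (ih l (fun t ht => hl t (by simp [ht]))).cons _

theorem hasInversePair_of_tripleInverse (hf : f.Injective) (l : List (Fin m × Fin m × Fin m))
    (hl : ∀ t ∈ l, tripleValid t) (h : tripleInverse l) :
    HasInversePair (l.map (tripleCyc f)) := by
  match l, hl, h with
  | a :: b :: l, hl, h =>
    simp only [tripleInverse, Bool.or_eq_true, decide_eq_true_eq] at h
    rcases h with h | h
    · have hb := hl b (by simp)
      simp only [tripleValid, ne_eq, Bool.and_eq_true, decide_eq_true_eq] at hb
      refine ⟨[], tripleCyc f a, l.map (tripleCyc f), ?_⟩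
      have e : tripleCyc f b = (tripleCyc f a)⁻¹ := by
        have r1 := cyc_rotate (hf.ne hb.1.1) (hf.ne hb.1.2) (hf.ne hb.2)
        have r2 := cyc_rotate (hf.ne hb.2) (hf.ne (Ne.symm hb.1.1)) (hf.ne (Ne.symm hb.1.2))
        simp only [tripleCyc, inv_cyc]
        rcases h with (rfl | rfl) | rfl
        · rfl
        · rw [r1, r2]
        · exact r1
      simp only [List.map_cons, e, List.nil_append]
      exact .refl _
    · have := hasInversePair_of_tripleInverse hf (b :: l) (fun t ht => hl t (by simp [ht])) h
      simpa using this.append [tripleCyc f a] []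

/-- An injective labelling transports a computation with labels to permutations of any type, so a
configuration is settled by a witness word and `decide`. -/
theorem hasInversePair_of_tripleCheck (hf : f.Injective) (w : List (Bool × ℕ)) (l : List (Fin m × Fin m × Fin m))
    (h : tripleCheck w l) : HasInversePair (l.map (tripleCyc f)) := by
  induction w generalizing l with
  | nil =>
    simp only [tripleCheck, Bool.and_eq_true, List.all_eq_true] at h
    exact hasInversePair_of_tripleInverse hf l h.1 h.2
  | cons s w ih =>
    simp only [tripleCheck, Bool.and_eq_true, List.all_eq_true] at h
    exact (ih _ h.2).of_braidEquiv (braidEquiv_tripleStep hf _ _ l h.1)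

end Words

/-! ### Explicit configurations containing an inverse pair -/

section Configurations

variable {α : Type*} [DecidableEq α]

open Equiv

/-- In the witness words, `(false, i)` is the forward move at position `i` and `(true, i)` the
inverse move. -/
theorem hasInversePair_cube_mul {x y z u v : α} (h : [x, y, z, u, v].Nodup) :
    HasInversePair [cyc x y z, cyc x y z, cyc x y z, cyc x u v] :=
  hasInversePair_of_tripleCheck (f := ![x, y, z, u, v]) (List.nodup_ofFn.1 (by simpa using h))
    [(false, 2), (true, 1), (false, 2), (true, 1), (false, 2), (true, 1), (false, 0)]
    [(0, 1, 2), (0, 1, 2), (0, 1, 2), (0, 3, 4)] (by decide)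

theorem hasInversePair_cube_mul_opposite {x y z u : α} (h : [x, y, z, u].Nodup) :
    HasInversePair [cyc x y z, cyc x y z, cyc x y z, cyc x y u] :=
  hasInversePair_of_tripleCheck (f := ![x, y, z, u]) (List.nodup_ofFn.1 (by simpa using h))
    [(false, 2), (true, 1), (false, 0), (false, 0), (true, 1)]
    [(0, 1, 2), (0, 1, 2), (0, 1, 2), (0, 1, 3)] (by decide)

/-- The first three entries have product one and live on four points; the last entry meets these in
a single point. The companion below treats an entry meeting them in two points. -/
theorem hasInversePair_triangle_one {f : Fin 6 → α} (hf : f.Injective) (p : Fin 6) (hp : p < 4) :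
    HasInversePair [cyc (f 0) (f 1) (f 2), cyc (f 0) (f 2) (f 3), cyc (f 3) (f 2) (f 1),
      cyc (f p) (f 4) (f 5)] := by
  have key : ∀ p : Fin 6, p < 4 → ∃ w ∈ [[(false, 1), (true, 2), (true, 2), (true, 1), (false, 0)],
      [(false, 2), (false, 2), (false, 1), (true, 0)],
      [(true, 2), (true, 2), (true, 1), (false, 0)],
      [(false, 2), (true, 1), (false, 0), (true, 1)]],
      tripleCheck w [(0, 1, 2), (0, 2, 3), (3, 2, 1), (p, 4, (5 : Fin 6))] = true := by decide
  obtain ⟨w, -, hw⟩ := key p hp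
  exact hasInversePair_of_tripleCheck hf w _ hw

theorem hasInversePair_triangle_two {f : Fin 5 → α} (hf : f.Injective) (p q : Fin 5)
    (hp : p < 4) (hq : q < 4) (hpq : p ≠ q) :
    HasInversePair [cyc (f 0) (f 1) (f 2), cyc (f 0) (f 2) (f 3), cyc (f 3) (f 2) (f 1),
      cyc (f p) (f q) (f 4)] := by
  have key : ∀ p q : Fin 5, p < 4 → q < 4 → p ≠ q →
      ∃ w ∈ [[(true, 2), (false, 1)], [(true, 0), (true, 2), (false, 1)],
        [(false, 0), (true, 2), (false, 1)], [(false, 0), (false, 2), (true, 1)],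
        [(false, 1), (true, 2), (false, 1)], [(true, 2), (true, 1), (false, 0)],
        [(false, 2), (true, 1)], [(false, 2), (true, 1), (false, 0)],
        [(true, 0), (false, 1), (true, 2), (false, 1)], [(true, 0), (false, 2), (true, 1)],
        [(false, 0), (false, 1), (true, 2), (false, 1)], [(false, 2), (false, 1), (true, 0)]],
      tripleCheck w [(0, 1, 2), (0, 2, 3), (3, 2, 1), (p, q, (4 : Fin 5))] = true := by decide
  obtain ⟨w, -, hw⟩ := key p q hp hq hpq
  exact hasInversePair_of_tripleCheck hf w _ hw

/-- The edge from `p` to `q` runs against the cyclic order `1, 2, 3` given by the product of the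
first two entries. -/
theorem hasInversePair_same_sign {f : Fin 5 → α} (hf : f.Injective) {p q : Fin 5}
    (h : p = 2 ∧ q = 1 ∨ p = 3 ∧ q = 2 ∨ p = 1 ∧ q = 3) :
    HasInversePair [cyc (f 0) (f 1) (f 2), cyc (f 0) (f 2) (f 3), cyc (f 4) (f p) (f q)] := by
  have key : ∀ p q : Fin 5, (p = 2 ∧ q = 1 ∨ p = 3 ∧ q = 2 ∨ p = 1 ∧ q = 3) →
      ∃ w ∈ [[(false, 1), (true, 0)], [(false, 0), (true, 1), (false, 0)],
        [(true, 1), (false, 0)]],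
      tripleCheck w [(0, 1, 2), (0, 2, 3), ((4 : Fin 5), p, q)] = true := by decide
  obtain ⟨w, -, hw⟩ := key p q h
  exact hasInversePair_of_tripleCheck hf w _ hw

/-- Here both pairs follow the same cyclic order: each has product `(1 2 3)`, which is also the last
entry. -/
theorem hasInversePair_two_pairs {f : Fin 5 → α} (hf : f.Injective) {p q s : Fin 5}
    (h : p = 1 ∧ q = 2 ∧ s = 3 ∨ p = 2 ∧ q = 3 ∧ s = 1 ∨ p = 3 ∧ q = 1 ∧ s = 2) :
    HasInversePair [cyc (f 0) (f 1) (f 2), cyc (f 0) (f 2) (f 3), cyc (f 4) (f p) (f q),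
      cyc (f 4) (f q) (f s), cyc (f 1) (f 2) (f 3)] := by
  have key : ∀ p q s : Fin 5,
      (p = 1 ∧ q = 2 ∧ s = 3 ∨ p = 2 ∧ q = 3 ∧ s = 1 ∨ p = 3 ∧ q = 1 ∧ s = 2) →
      ∃ w ∈ [[(false, 3), (true, 2), (true, 1), (false, 0)],
        [(false, 3), (true, 2), (false, 1), (true, 0)],
        [(true, 3), (false, 2), (false, 1), (true, 0)]],
      tripleCheck w [(0, 1, 2), (0, 2, 3), ((4 : Fin 5), p, q), (4, q, s), (1, 2, 3)] = true := by
    decide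
  obtain ⟨w, -, hw⟩ := key p q s h
  exact hasInversePair_of_tripleCheck hf w _ hw

end Configurations

/-! ### Connected lists; cubes and triangles -/

section Connected

variable {α : Type*}

open Equiv

/-- No nonempty proper subset of `S` is preserved by all permutations in the list. -/
def ConnectedOn (S : Finset α) (l : List (Perm α)) : Prop :=
  ∀ T ⊆ S, T.Nonempty → (∀ g ∈ l, ∀ x, g x ∈ T ↔ x ∈ T) → T = S

theorem ConnectedOn.of_braidEquiv {S : Finset α} {l m : List (Perm α)} (h : BraidEquiv l m)
    (hl : ConnectedOn S l) : ConnectedOn S m := by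
  intro T hT hne hm
  let H : Subgroup (Perm α) :=
    { carrier := {g | ∀ x, g x ∈ T ↔ x ∈ T}
      mul_mem' := fun {a b} ha hb x => (ha (b x)).trans (hb x)
      one_mem' := fun x => Iff.rfl
      inv_mem' := fun {a} ha x => by simpa using (ha (a⁻¹ x)).symm }
  exact hl T hT hne (h.symm.forall_mem_subgroup H hm)

theorem apply_mem_iff_of_moved_mem {g : Perm α} {T : Finset α} (h : ∀ p, g p ≠ p → p ∈ T)
    (x : α) : g x ∈ T ↔ x ∈ T := by
  by_cases hx : g x = x
  · rw [hx]
  · exact iff_of_true (h _ fun h' => hx (g.injective h')) (h _ hx)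

theorem apply_mem_iff_of_fixed {g : Perm α} {T : Finset α} (h : ∀ p ∈ T, g p = p)
    (x : α) : g x ∈ T ↔ x ∈ T :=
  ⟨fun hx => by rwa [← g.injective (h _ hx)], fun hx => by rwa [h _ hx]⟩

variable [DecidableEq α] [Fintype α]

/-- If `d ∘ d` mapped `T` into itself for each entry `d`, then so would `d = d ^ 4`, and `T` would
be invariant. Using `d (d p)`, the predecessor of `p`, gives `d = (p q r)` with `r` outside `T` and
`q` on either side. -/
theorem ConnectedOn.exists_crossing {S : Finset α} {l : List (Perm α)} (h : ConnectedOn S l)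
    (hl : ∀ g ∈ l, g.IsThreeCycle) {T : Finset α} (hT : T ⊆ S) (hne : T.Nonempty)
    (hcard : T.card < S.card) : ∃ d ∈ l, ∃ p ∈ T, d (d p) ∉ T := by
  by_contra! hcon
  have := h T hT hne fun g hg x => by
    have h3 := isThreeCycle_pow_three (hl g hg)
    constructor
    · intro hx
      have := hcon g hg _ hx
      rwa [h3] at this
    · intro hx
      have := hcon g hg _ (hcon g hg _ hx)
      rwa [h3] at this
  rw [this] at hcard
  exact lt_irrefl _ hcard

/-- Write `a = (p x y)` and `d = (p q r)` with `r` fixed by `a`. The cases `q = x` and `q` outside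
the support of `a` are explicit configurations; only `q = y` remains. -/
theorem hasInversePair_cube_or {a d : Perm α} (ha : a.IsThreeCycle) (hd : d.IsThreeCycle) {p : α}
    (hp : a p ≠ p) (hr : a (d (d p)) = d (d p)) :
    HasInversePair [a, a, a, d] ∨ d p = a (a p) := by
  have hdp : d p ≠ p := fun h => hp (by rwa [h, h] at hr)
  obtain ⟨x, y, hpx, hpy, hxy, rfl⟩ := exists_eq_cyc ha hp
  obtain ⟨q, r, hpq, hpr, hqr, rfl⟩ := exists_eq_cyc hd hdp
  simp only [cyc_apply hpx hpy hxy, cyc_apply hpq hpr hqr, if_true, hpq.symm, if_false,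
    hpr.symm, hpx.symm] at hr ⊢
  have hrx : r ≠ x := by rintro rfl; simp at hr; exact hxy hr.symm
  have hry : r ≠ y := by rintro rfl; simp [hrx] at hr; exact hpr hr
  by_cases hqy : q = y
  · exact .inr hqy
  left
  by_cases hqx : q = x
  · subst hqx
    exact hasInversePair_cube_mul_opposite (by simp; tauto)
  · exact hasInversePair_cube_mul (by simp; tauto)

/-- The block has product one, so it slides to just behind `d`. Moving `d` back across it conjugates
the block and leaves `d` unchanged; the block then slides home. -/
theorem braidEquiv_cube_conj {G : Type*} [Group G] {a d : G} (ha : a * a * a = 1) {R : List G}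
    (hd : d ∈ R) : BraidEquiv ([a, a, a] ++ R)
      ([d * a * d⁻¹, d * a * d⁻¹, d * a * d⁻¹] ++ R) := by
  obtain ⟨u, v, rfl⟩ := List.append_of_mem hd
  have h1 := (BraidEquiv.swap_of_prod_eq_one (u ++ [d]) [a, a, a] (by simp [← mul_assoc, ha])).symm
  have h2 := (BraidEquiv.move_right d [a, a, a]).append_left u
  have h3 := (BraidEquiv.swap_of_prod_eq_one u [d * a * d⁻¹, d * a * d⁻¹, d * a * d⁻¹]
    (by
      have : d * (a * a * a) * d⁻¹ = 1 := by simp [ha]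
      simpa [mul_assoc] using this)).append_right [d]
  have h := ((h1.trans (by simpa using h2)).trans (by simpa using h3)).append_right v
  simpa using h

theorem braidEquiv_cube_conj_inv {G : Type*} [Group G] {a d : G} (ha : a * a * a = 1) {R : List G}
    (hd : d ∈ R) : BraidEquiv ([a, a, a] ++ R)
      ([d⁻¹ * a * d, d⁻¹ * a * d, d⁻¹ * a * d] ++ R) := by
  have h := braidEquiv_cube_conj (a := d⁻¹ * a * d) (by
    have : d⁻¹ * (a * a * a) * d = 1 := by simp [ha]
    simpa [mul_assoc] using this) hd
  simpa [mul_assoc] using h.symm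

theorem hasInversePair_of_block {G : Type*} [Group G] {B : List G} (hB : B.prod = 1) {R : List G}
    {d : G} (hd : d ∈ R) (h : HasInversePair (B ++ [d])) : HasInversePair (B ++ R) := by
  obtain ⟨u, v, rfl⟩ := List.append_of_mem hd
  have h1 := (BraidEquiv.swap_of_prod_eq_one u B hB).symm.append_right (d :: v)
  refine HasInversePair.of_braidEquiv (m := u ++ (B ++ [d]) ++ v) ?_ (h.append u v)
  simpa using h1

theorem mul_self_mul_self_of_isThreeCycle {a : Perm α} (ha : a.IsThreeCycle) : a * a * a = 1 := by
  ext n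
  simpa using isThreeCycle_pow_three ha n

/-- Three equal entries in a connected tuple on at least five points. -/
theorem hasInversePair_of_cube {S : Finset α} (hS : 5 ≤ S.card) {a : Perm α} {R : List (Perm α)}
    (hl : ∀ g ∈ a :: R, g.IsThreeCycle) (hsupp : ∀ g ∈ a :: R, ∀ p, g p ≠ p → p ∈ S)
    (hconn : ConnectedOn S (a :: a :: a :: R)) : HasInversePair (a :: a :: a :: R) := by
  by_contra hbad
  have ha : a.IsThreeCycle := hl a (by simp)
  have ha3 := mul_self_mul_self_of_isThreeCycle ha
  have hl' : ∀ g ∈ a :: a :: a :: R, g.IsThreeCycle := by simpa using hl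
  -- Without an inverse pair, every cube `e, e, e` reachable with the same `R` forces the value `d p
  -- = e (e p)` on each entry of `R` leading out of its support.
  have key (e : Perm α) (he : BraidEquiv ([a, a, a] ++ R) ([e, e, e] ++ R))
      (het : e.IsThreeCycle) (d : Perm α) (hd : d ∈ R) (p : α) (hp : e p ≠ p)
      (hr : e (d (d p)) = d (d p)) : d p = e (e p) := by
    refine (hasInversePair_cube_or het (hl d (by simp [hd])) hp hr).resolve_left fun h => hbad ?_
    exact (hasInversePair_of_block (B := [e, e, e]) (by
      simpa [mul_assoc] using mul_self_mul_self_of_isThreeCycle het) hd h).of_braidEquiv he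
  have hSa : ∀ p, a p ≠ p → p ∈ S := hsupp a (by simp)
  obtain ⟨d, hd, x, hx, hxd⟩ := hconn.exists_crossing hl' (T := a.support)
    (fun p hp => hSa p (Perm.mem_support.1 hp)) (by
      rw [← Finset.card_pos, ha.card_support]; norm_num) (by rw [ha.card_support]; omega)
  rw [Perm.mem_support] at hx
  rw [Perm.notMem_support] at hxd
  have hda : d ≠ a := by
    rintro rfl
    rw [isThreeCycle_pow_three ha] at hxd
    exact isThreeCycle_apply_apply_ne ha hx hxd.symm
  have hdR : d ∈ R := by simpa [hda] using hd
  have hdt := hl d (by simp [hdR])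
  have hdx := key a (.refl _) ha d hdR x hx hxd
  have hdx' : d x ≠ x := by rw [hdx]; exact isThreeCycle_apply_apply_ne ha hx
  have hSd : ∀ p, d p ≠ p → p ∈ S := hsupp d (by simp [hdR])
  have key1 := key _ (braidEquiv_cube_conj ha3 hdR) (isThreeCycle_conj ha d)
  have key2 := key _ (braidEquiv_cube_conj_inv ha3 hdR) (by simpa using isThreeCycle_conj ha d⁻¹)
  have key0 := key _ (.refl _) ha
  have hconj := mul_cyc_mul_inv d
  have hconj' := mul_cyc_mul_inv d⁻¹
  obtain ⟨y, z, hxy, hxz, hyz, rfl⟩ := exists_eq_cyc ha hx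
  obtain ⟨z', w, hxz', hxw, hz'w, rfl⟩ := exists_eq_cyc hdt hdx'
  have hz : z' = z := by
    simpa [cyc_apply hxz' hxw hz'w, cyc_apply hxy hxz hyz, hxy.symm] using hdx
  subst hz
  have hw : cyc x y z' w = w := by
    simpa [cyc_apply hxz' hxw hz'w, hxz'.symm] using hxd
  have hyw : y ≠ w := by
    rintro rfl
    simp [cyc_apply hxy hxz hyz, hxy.symm, hyz.symm] at hw
  -- With `a = (x y z')` and `d = (x z' w)`, conjugating the cube both ways by `d` gives further
  -- cubes of `(z' y w)` and `(w y x)`.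
  have e1 : cyc x z' w * cyc x y z' * (cyc x z' w)⁻¹ = cyc z' y w := by
    rw [hconj, cyc_apply hxz' hxw hz'w, cyc_apply hxz' hxw hz'w, cyc_apply hxz' hxw hz'w]
    simp [hxy.symm, hyz, hyw, hxz'.symm]
  have e2 : (cyc x z' w)⁻¹ * cyc x y z' * cyc x z' w = cyc w y x := by
    have := hconj' x y z'
    rw [inv_inv] at this
    rw [this, inv_cyc, cyc_apply hz'w.symm hxw.symm hxz'.symm,
      cyc_apply hz'w.symm hxw.symm hxz'.symm, cyc_apply hz'w.symm hxw.symm hxz'.symm]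
    simp [hxy.symm, hyz, hyw, hxz', hxw, hz'w]
  rw [e1] at key1
  rw [e2] at key2
  -- A fifth point provides an entry `d2` leading out of `{x, y, z', w}`.
  obtain ⟨d2, hd2, p, hp, hpd⟩ := hconn.exists_crossing hl' (T := {x, y, z', w})
    (by
      intro p hp
      simp only [Finset.mem_insert, Finset.mem_singleton] at hp
      rcases hp with rfl | rfl | rfl | rfl
      · exact hSd _ hdx'
      · exact hSa _ (by simp [cyc_apply hxy hxz hyz, hxy.symm, hyz.symm])
      · exact hSa _ (by simp [cyc_apply hxy hxz hyz, hxz, hxz.symm, hyz.symm])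
      · exact hSd _ (by simp [cyc_apply hxz' hxw hz'w, hxw, hxw.symm, hz'w.symm]))
    (by simp) (lt_of_le_of_lt Finset.card_le_four (by omega))
  have hd2R : d2 ∈ R := by
    have : d2 ≠ cyc x y z' := by
      rintro rfl
      apply hpd
      have hst := apply_mem_iff_of_moved_mem (g := cyc x y z') (T := {x, y, z', w}) (by
        intro q hq
        rw [cyc_apply hxy hxz hyz] at hq
        simp only [Finset.mem_insert, Finset.mem_singleton]
        split_ifs at hq <;> tauto)
      rw [hst, hst]
      exact hp
    simpa [this] using hd2
  simp only [Finset.mem_insert, Finset.mem_singleton, not_or] at hp hpd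
  obtain ⟨r1, r2, r3, r4⟩ := hpd
  have k0 := key0 d2 hd2R p
  have k1 := key1 d2 hd2R p
  have k2 := key2 d2 hd2R p
  simp only [cyc_apply hxy hxz hyz, cyc_apply hyz.symm hz'w hyw, cyc_apply hyw.symm hxw.symm
    hxy.symm, r1, r2, r3, r4, if_false, forall_const] at k0 k1 k2
  have hyx := hxy.symm
  have hzx := hxz.symm
  have hzy := hyz.symm
  have hwx := hxw.symm
  have hwy := hyw.symm
  have hwz := hz'w.symm
  clear key key0 key1 key2 hconj hconj' e1 e2 hl hl' hsupp hconn hbad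
  -- Each of the four points lies on two of the three cycles with different predecessors, so `d2 p`
  -- would have two values.
  rcases hp with rfl | rfl | rfl | rfl
  · simp only [if_true, if_false, ne_eq, not_false_eq_true, forall_const, hyx, hwx, hwy, hxy, hxz,
      hxw, hyz] at k0 k2
    exact hyz (k2.symm.trans k0)
  · simp only [if_true, if_false, ne_eq, not_false_eq_true, forall_const, hyx, hyz, hyw, hzx, hzy,
      hwy, hwz] at k0 k1
    exact hxz (k0.symm.trans k1)
  · simp only [if_true, if_false, ne_eq, not_false_eq_true, forall_const, hzx, hzy, hxy, hxz, hyz,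
      hyw, hz'w] at k0 k1
    exact hyw (k0.symm.trans k1)
  · simp only [if_true, if_false, ne_eq, not_false_eq_true, forall_const, hwx, hwy, hwz, hyx, hyw,
      hzy, hz'w] at k1 k2
    exact hxy (k2.symm.trans k1)

/-- Three entries `a, b, (a * b)⁻¹` with two of them sharing an edge in a connected tuple on at
least five points. -/
theorem hasInversePair_of_triangle {S : Finset α} (hS : 5 ≤ S.card) {n x y w : α}
    (hnd : [n, x, y, w].Nodup) {R : List (Perm α)}
    (hl : ∀ g ∈ R, g.IsThreeCycle) (hsupp : ∀ p ∈ [n, x, y, w], p ∈ S)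
    (hconn : ConnectedOn S ([cyc n x y, cyc n y w, cyc w y x] ++ R)) :
    HasInversePair ([cyc n x y, cyc n y w, cyc w y x] ++ R) := by
  simp only [List.nodup_cons, List.mem_cons, List.not_mem_nil, or_false, not_or, not_false_eq_true,
    List.nodup_nil, and_true] at hnd
  obtain ⟨⟨hnx, hny, hnw⟩, ⟨hxy, hxw⟩, hyw⟩ := hnd
  have hB : [cyc n x y, cyc n y w, cyc w y x].prod = 1 := by
    rw [← inv_cyc (x := x)]
    simp [← mul_assoc, cyc_mul_cyc hnx hny hnw hxy hxw hyw]
  obtain ⟨d, hd, p, hp, hpd⟩ := hconn.exists_crossing (T := {n, x, y, w})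
    (by
      intro g hg
      simp only [List.cons_append, List.nil_append, List.mem_cons] at hg
      rcases hg with rfl | rfl | rfl | hg
      · exact isThreeCycle_cyc hnx hny hxy
      · exact isThreeCycle_cyc hny hnw hyw
      · exact isThreeCycle_cyc (Ne.symm hyw) (Ne.symm hxw) (Ne.symm hxy)
      · exact hl g hg)
    (fun p hp => hsupp p (by simpa using hp)) (by simp)
    (lt_of_le_of_lt Finset.card_le_four (by omega))
  have hdR : d ∈ R := by
    have hst (i j k : α) (hij : i ≠ j) (hik : i ≠ k) (hjk : j ≠ k)
        (h : ∀ q, q = i ∨ q = j ∨ q = k → q ∈ ({n, x, y, w} : Finset α)) :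
        d ≠ cyc i j k := by
      rintro rfl
      have := apply_mem_iff_of_moved_mem (g := cyc i j k) (T := {n, x, y, w}) (fun q hq => h q (by
        rw [cyc_apply hij hik hjk] at hq
        split_ifs at hq <;> tauto))
      exact hpd (by rwa [this, this])
    have h1 := hst n x y hnx hny hxy (by simp)
    have h2 := hst n y w hny hnw hyw (by simp)
    have h3 := hst w y x (Ne.symm hyw) (Ne.symm hxw) (Ne.symm hxy) (by simp)
    simpa [h1, h2, h3] using hd
  refine hasInversePair_of_block hB hdR ?_
  have hdp : d p ≠ p := fun h => hpd (by rwa [h, h])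
  obtain ⟨q, r, hpq, hpr, hqr, rfl⟩ := exists_eq_cyc (hl d hdR) hdp
  have hrT : r ∉ ({n, x, y, w} : Finset α) := by
    simpa [cyc_apply hpq hpr hqr, hpq.symm] using hpd
  have hind (s : α) (hs : s ∈ ({n, x, y, w} : Finset α)) : ∃ i : Fin 4, s = ![n, x, y, w] i := by
    simp only [Finset.mem_insert, Finset.mem_singleton] at hs
    rcases hs with rfl | rfl | rfl | rfl
    exacts [⟨0, rfl⟩, ⟨1, rfl⟩, ⟨2, rfl⟩, ⟨3, rfl⟩]
  obtain ⟨i, hi⟩ := hind p hp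
  have hr := hrT
  simp only [Finset.mem_insert, Finset.mem_singleton, not_or] at hr
  -- The crossing entry is `(p q r)` with `r` outside the four points; `q` decides which
  -- configuration applies.
  by_cases hqT : q ∈ ({n, x, y, w} : Finset α)
  · obtain ⟨j, hj⟩ := hind q hqT
    have hinj : Function.Injective ![n, x, y, w, r] := List.nodup_ofFn.1 (by simp; tauto)
    have hij : i ≠ j := by rintro rfl; exact hpq (hi.trans hj.symm)
    have := hasInversePair_triangle_two hinj i.castSucc j.castSucc i.castSucc_lt_last j.castSucc_lt_last
      (by simpa using hij)
    have ei : ![n, x, y, w, r] i.castSucc = p := by rw [hi]; fin_cases i <;> rfl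
    have ej : ![n, x, y, w, r] j.castSucc = q := by rw [hj]; fin_cases j <;> rfl
    rw [ei, ej] at this
    exact this
  · have hq := hqT
    simp only [Finset.mem_insert, Finset.mem_singleton, not_or] at hq
    have hinj : Function.Injective ![n, x, y, w, q, r] := List.nodup_ofFn.1 (by simp; tauto)
    have := hasInversePair_triangle_one hinj i.castSucc.castSucc
      ((by decide : ∀ i : Fin 4, i.castSucc.castSucc < (4 : Fin 6)) i)
    have ei : ![n, x, y, w, q, r] i.castSucc.castSucc = p := by rw [hi]; fin_cases i <;> rfl
    rw [ei] at this
    exact this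

end Connected

/-! ### The block of entries moving a given point -/

section Blocks

variable {α : Type*}

open Equiv

theorem list_prod_apply_eq {l : List (Perm α)} {n : α} (h : ∀ g ∈ l, g n = n) : l.prod n = n := by
  induction l with
  | nil => rfl
  | cons a l ih =>
    rw [List.prod_cons, Perm.mul_apply, ih fun g hg => h g (by simp [hg]), h a (by simp)]

variable [DecidableEq α] [Fintype α]

/-- The two conjugates move `n` exactly when `b` moves `a⁻¹ n` and `a` moves `b n`. Hence `b n` is
`a n`, forcing `a = b`, or it is `a (a n)`; in the latter case `b (b n) = a n` would mean `b = a⁻¹`.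
-/
theorem isThreeCycle_eq_or_of_conj_moved {a b : Perm α} (ha : a.IsThreeCycle)
    (hb : b.IsThreeCycle) {n : α} (han : a n ≠ n) (hbn : b n ≠ n) (h1 : (a * b * a⁻¹) n ≠ n)
    (h2 : (b⁻¹ * a * b) n ≠ n) (hne : b ≠ a⁻¹) :
    a = b ∨ (b n = a (a n) ∧ b (b n) ≠ a n) := by
  have a3 := isThreeCycle_pow_three ha
  have haa := isThreeCycle_apply_apply_ne ha han
  have h1' : b (a (a n)) ≠ a (a n) := by
    intro h
    apply h1
    rw [Perm.mul_apply, Perm.mul_apply, isThreeCycle_inv_apply ha, h, a3]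
  have h2' : a (b n) ≠ b n := by
    intro h
    apply h2
    rw [Perm.mul_apply, Perm.mul_apply, h, Perm.inv_eq_iff_eq]
  rcases isThreeCycle_eq_or ha han h2' with h | h | h
  · exact absurd h hbn
  · rcases isThreeCycle_eq_or hb hbn h1' with h' | h' | h'
    · exact absurd h' haa
    · exact absurd (a.injective (h'.trans h)) han
    · exact .inl (isThreeCycle_ext ha hb han h.symm h')
  · refine .inr ⟨h, fun h' => hne ?_⟩
    refine isThreeCycle_ext hb ha.inv hbn ?_ ?_
    · rw [h, isThreeCycle_inv_apply ha]
    · rw [h', isThreeCycle_inv_apply ha, isThreeCycle_inv_apply ha, a3]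

theorem BraidEquiv.forall_isThreeCycle {l m : List (Perm α)} (h : BraidEquiv l m)
    (hl : ∀ g ∈ l, g.IsThreeCycle) : ∀ g ∈ m, g.IsThreeCycle :=
  h.forall_mem_of_conj (fun a _ hb => isThreeCycle_conj hb a) hl

/-- A list of 3-cycles whose braid orbit consists of lists of permutations moving `n`. -/
theorem eq_replicate_or_eq_pair {L : List (Perm α)} (hL : ∀ g ∈ L, g.IsThreeCycle) {n : α}
    (hn : ∀ L', BraidEquiv L L' → ∀ g ∈ L', g n ≠ n) (hbad : ¬ HasInversePair L) :
    (∃ a k, L = List.replicate k a) ∨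
      ∃ x y w, [n, x, y, w].Nodup ∧ L = [cyc n x y, cyc n y w] := by
  have cycs {L' : List (Perm α)} (h : BraidEquiv L L') := h.forall_isThreeCycle hL
  have adj {u v : List (Perm α)} {a b : Perm α} (h : BraidEquiv L (u ++ a :: b :: v)) :
      a = b ∨ (b n = a (a n) ∧ b (b n) ≠ a n) := by
    refine isThreeCycle_eq_or_of_conj_moved (cycs h a (by simp)) (cycs h b (by simp))
      (hn _ h a (by simp)) (hn _ h b (by simp))
      (hn _ (h.trans (.fwd u a b v)) _ (by simp)) (hn _ (h.trans (.bwd u a b v)) _ (by simp)) ?_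
    rintro rfl
    exact hbad ⟨u, a, v, h⟩
  -- Three consecutive entries must agree: the dichotomy for `a, b`, for `b, c`, for `a, c` after
  -- moving `c` left, and for one further braiding rules out everything else.
  have triple {u v : List (Perm α)} {a b c : Perm α}
      (h : BraidEquiv L (u ++ a :: b :: c :: v)) : a = b ∧ b = c := by
    have ha := cycs h a (by simp)
    have hb := cycs h b (by simp)
    have hc := cycs h c (by simp)
    have han := hn _ h a (by simp)
    have hbn := hn _ h b (by simp)
    have hcn := hn _ h c (by simp)
    have hab := adj h
    have hbc := adj (u := u ++ [a]) (v := v) (a := b) (b := c) (by simpa using h)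
    have hleft : BraidEquiv L (u ++ a :: c :: (c⁻¹ * b * c) :: v) :=
      h.trans (by simpa using BraidEquiv.bwd (u ++ [a]) b c v)
    have hac := adj hleft
    by_cases e1 : a = b
    · subst e1
      refine ⟨rfl, ?_⟩
      by_contra e2
      have h3 : BraidEquiv L (u ++ a :: (a * c * a⁻¹) :: a :: v) :=
        h.trans (by simpa using BraidEquiv.fwd (u ++ [a]) a c v)
      obtain ⟨hc1, hc2⟩ := hac.resolve_left e2
      rcases adj h3 with h4 | ⟨h4, -⟩
      · apply e2
        have := congrArg (fun g => a⁻¹ * g * a) h4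
        simpa [mul_assoc] using this
      · rw [Perm.mul_apply, Perm.mul_apply, isThreeCycle_inv_apply ha, ← hc1] at h4
        have := a.injective (h4.trans hc1)
        exact hc2 this
    · exfalso
      obtain ⟨hb1, hb2⟩ := hab.resolve_left e1
      rcases hbc with rfl | ⟨hc1, hc2⟩
      · have h3 : BraidEquiv L (u ++ b :: (b⁻¹ * a * b) :: b :: v) := h.trans (.bwd u a b _)
        rcases adj (u := u ++ [b]) (v := v) (a := b⁻¹ * a * b) (b := b) (by simpa using h3)
          with h4 | ⟨h4, -⟩
        · apply e1
          have := congrArg (fun g => b * g * b⁻¹) h4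
          simpa [mul_assoc] using this
        · have e (z : α) : b (b⁻¹ z) = z := by simp
          simp only [Perm.mul_apply, e] at h4
          rw [hb1, isThreeCycle_pow_three ha, Perm.eq_inv_iff_eq, ← hb1] at h4
          exact hb2 h4
      · rcases hac with rfl | ⟨hc3, -⟩
        · exact hb2 hc1.symm
        · exact hbn (b.injective (hc1.symm.trans (hc3.trans hb1.symm)))
  match L with
  | [] => exact .inl ⟨1, 0, rfl⟩
  | [a] => exact .inl ⟨a, 1, rfl⟩
  | [a, b] =>
    rcases adj (u := []) (BraidEquiv.refl [a, b]) with rfl | ⟨h1, h2⟩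
    · exact .inl ⟨a, 2, rfl⟩
    · right
      have ha := hL a (by simp)
      have hb := hL b (by simp)
      have han := hn _ (.refl _) a (by simp)
      have hbn := hn _ (.refl _) b (by simp)
      refine ⟨a n, a (a n), b (b n), ?_, ?_⟩
      · have e1 := isThreeCycle_apply_apply_ne ha han
        have e2 := isThreeCycle_apply_apply_ne hb hbn
        have e3 : a n ≠ a (a n) := fun h => han (a.injective h).symm
        have e4 : a (a n) ≠ b (b n) := fun h => hbn (b.injective (h1.trans h)).symm
        simp only [List.nodup_cons, List.mem_cons, List.not_mem_nil, or_false, not_or,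
          not_false_eq_true, List.nodup_nil, and_true]
        exact ⟨⟨han.symm, e1.symm, e2.symm⟩, ⟨e3, h2.symm⟩, e4⟩
      · rw [← isThreeCycle_eq_cyc ha han, ← h1, ← isThreeCycle_eq_cyc hb hbn]
  | a :: b :: c :: v =>
    left
    obtain ⟨rfl, rfl⟩ := triple (u := []) (BraidEquiv.refl (a :: b :: c :: v))
    -- Equality spreads to the right, one window of three entries at a time.
    have claim : ∀ (t : List (Perm α)) (k : ℕ), a :: a :: a :: v = List.replicate (k + 2) a ++ t →
        ∃ k, a :: a :: a :: v = List.replicate k a := by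
      intro t
      induction t with
      | nil => exact fun k h => ⟨k + 2, by simpa using h⟩
      | cons s t ih =>
        intro k h
        have e : List.replicate (k + 2) a ++ s :: t = List.replicate k a ++ a :: a :: s :: t := by
          simp [List.replicate_add]
        have h' := triple (u := List.replicate k a) (by rw [← e, ← h]; exact .refl _)
        obtain ⟨-, rfl⟩ := h'
        apply ih (k + 1)
        rw [h, e, show k + 1 + 2 = k + 3 from rfl]
        simp [List.replicate_add]
    obtain ⟨k, hk⟩ := claim (a :: v) 0 (by simp [List.replicate])
    exact ⟨a, k, hk⟩

-- Entries fixing `n` travel to the right. They conjugate the entries they pass, which still move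
-- `n` because the conjugator fixes it.
omit [Fintype α] in
theorem exists_braidEquiv_moved_append_fixed (n : α) (l : List (Perm α)) :
    ∃ L R, BraidEquiv l (L ++ R) ∧ (∀ g ∈ L, g n ≠ n) ∧ (∀ g ∈ R, g n = n) ∧
      L.length = l.countP (fun g => g n ≠ n) := by
  induction l with
  | nil => exact ⟨[], [], .refl _, by simp, by simp, by simp⟩
  | cons a l ih =>
    obtain ⟨L, R, h, hL, hR, hlen⟩ := ih
    by_cases ha : a n = n
    · refine ⟨L.map (fun g => a * g * a⁻¹), a :: R, (h.cons a).trans ?_, ?_, ?_, ?_⟩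
      · simpa using (BraidEquiv.move_right a L).append_right R
      · intro g hg
        obtain ⟨s, hs, rfl⟩ := List.mem_map.1 hg
        have ha' : a⁻¹ n = n := by rw [Perm.inv_eq_iff_eq, ha]
        intro h
        apply hL s hs
        rw [Perm.mul_apply, Perm.mul_apply, ha'] at h
        exact a.injective (h.trans ha.symm)
      · simpa [ha] using hR
      · simp [ha, hlen]
    · refine ⟨a :: L, R, h.cons a, ?_, hR, ?_⟩
      · simpa [ha] using hL
      · simp [ha, hlen]

theorem exists_block {l : List (Perm α)} (hl : ∀ g ∈ l, g.IsThreeCycle)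
    (hbad : ¬ HasInversePair l) (n : α) :
    ∃ L R, BraidEquiv l (L ++ R) ∧ (∀ g ∈ L, g n ≠ n) ∧ (∀ g ∈ R, g n = n) ∧
      ((∃ a k, L = List.replicate k a) ∨
        ∃ x y w, [n, x, y, w].Nodup ∧ L = [cyc n x y, cyc n y w]) := by
  classical
  -- Choose a list in the orbit with the fewest entries moving `n`.
  have hex : ∃ c, ∃ l', BraidEquiv l l' ∧ l'.countP (fun g => g n ≠ n) = c :=
    ⟨_, l, .refl _, rfl⟩
  obtain ⟨l', hl', hc⟩ := Nat.find_spec hex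
  have hmin := fun l'' (h : BraidEquiv l l'') => Nat.find_min' hex ⟨l'', h, rfl⟩
  rw [← hc] at hmin
  obtain ⟨L, R, h, hL, hR, hlen⟩ := exists_braidEquiv_moved_append_fixed n l'
  refine ⟨L, R, hl'.trans h, hL, hR, eq_replicate_or_eq_pair (n := n) ?_ ?_ ?_⟩
  · exact fun g hg => (hl'.trans h).forall_isThreeCycle hl g (by simp [hg])
  · intro L' hL'
    -- Braiding `L` alone cannot lower this minimum, and `R` contributes nothing to it, so all
    -- entries still move `n`.
    have h1 := hmin _ ((hl'.trans h).trans (hL'.append_right R))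
    have h2 : R.countP (fun g => g n ≠ n) = 0 := by
      rw [List.countP_eq_zero]
      simpa using hR
    rw [List.countP_append, h2, add_zero, ← hlen, hL'.length_eq] at h1
    have h3 := List.countP_eq_length.1 (le_antisymm List.countP_le_length h1)
    simpa using h3
  · intro hg
    exact hbad (HasInversePair.of_braidEquiv (hl'.trans h) (by simpa using hg.append [] R))

theorem three_dvd_of_pow_apply_eq {a : Perm α} (ha : a.IsThreeCycle) {n : α} (hn : a n ≠ n)
    {k : ℕ} (hk : (a ^ k) n = n) : 3 ∣ k := by
  rw [← pow_mod_orderOf, ha.orderOf] at hk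
  have : k % 3 < 3 := Nat.mod_lt _ (by norm_num)
  rw [Nat.dvd_iff_mod_eq_zero]
  interval_cases h : k % 3
  · rfl
  · exact absurd (by simpa using hk) hn
  · exact absurd (by simpa [pow_succ] using hk) (isThreeCycle_apply_apply_ne ha hn)

end Blocks

/-! ### Merging, five points, and the induction -/

section Main

variable {α : Type*} [DecidableEq α] [Fintype α]

open Equiv

omit [DecidableEq α] [Fintype α] in
theorem BraidEquiv.forall_moved_mem {S : Finset α} {l m : List (Perm α)} (h : BraidEquiv l m)
    (hl : ∀ g ∈ l, ∀ p, g p ≠ p → p ∈ S) : ∀ g ∈ m, ∀ p, g p ≠ p → p ∈ S := by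
  let H : Subgroup (Perm α) :=
    { carrier := {g | ∀ p, p ∉ S → g p = p}
      mul_mem' := fun {a b} ha hb p hp => by rw [Perm.mul_apply, hb p hp, ha p hp]
      one_mem' := fun _ _ => rfl
      inv_mem' := fun {a} ha p hp => by rw [Perm.inv_eq_iff_eq, ha p hp] }
  have := h.forall_mem_subgroup H fun g hg p hp => by_contra fun h' => hp (hl g hg p h')
  exact fun g hg p hp => by_contra fun h' => hp (this g hg p h')

theorem hasInversePair_of_braidEquiv_cube {S : Finset α} (hS : 5 ≤ S.card) {l : List (Perm α)}
    (hl : ∀ g ∈ l, g.IsThreeCycle) (hsupp : ∀ g ∈ l, ∀ p, g p ≠ p → p ∈ S)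
    (hconn : ConnectedOn S l) {a : Perm α} {R : List (Perm α)}
    (h : BraidEquiv l (a :: a :: a :: R)) : HasInversePair l := by
  refine HasInversePair.of_braidEquiv h (hasInversePair_of_cube hS ?_ ?_ (hconn.of_braidEquiv h))
  · have := h.forall_isThreeCycle hl
    simpa using this
  · have := h.forall_moved_mem hsupp
    simpa using this

theorem hasInversePair_of_braidEquiv_triangle {S : Finset α} (hS : 5 ≤ S.card)
    {l : List (Perm α)} (hl : ∀ g ∈ l, g.IsThreeCycle)
    (hsupp : ∀ g ∈ l, ∀ p, g p ≠ p → p ∈ S) (hconn : ConnectedOn S l) {n x y w : α}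
    (hnd : [n, x, y, w].Nodup) {u v : List (Perm α)}
    (h : BraidEquiv l (u ++ cyc n x y :: cyc n y w :: cyc w y x :: v)) : HasInversePair l := by
  have hnd' := hnd
  simp only [List.nodup_cons, List.mem_cons, List.not_mem_nil, or_false, not_or, not_false_eq_true,
    List.nodup_nil, and_true] at hnd'
  obtain ⟨⟨hnx, hny, hnw⟩, ⟨hxy, hxw⟩, hyw⟩ := hnd'
  have hB : [cyc n x y, cyc n y w, cyc w y x].prod = 1 := by
    rw [← inv_cyc (x := x)]
    simp [← mul_assoc, cyc_mul_cyc hnx hny hnw hxy hxw hyw]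
  have h1 := h.trans (k := u ++ [cyc n x y, cyc n y w, cyc w y x] ++ v) (by
    simpa using BraidEquiv.refl _)
  have h2 := h1.trans ((BraidEquiv.swap_of_prod_eq_one u _ hB).append_right v)
  rw [List.append_assoc] at h2
  have hs := h2.forall_moved_mem hsupp
  refine HasInversePair.of_braidEquiv h2 (hasInversePair_of_triangle hS hnd ?_ ?_
    (hconn.of_braidEquiv h2))
  · exact fun g hg => h2.forall_isThreeCycle hl g (List.mem_append_right _ hg)
  · intro p hp
    simp only [List.mem_cons, List.not_mem_nil, or_false] at hp
    have c1 := hs (cyc n x y) (by simp)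
    have c2 := hs (cyc n y w) (by simp)
    rcases hp with rfl | rfl | rfl | rfl
    · exact c1 _ (by simp [cyc_apply hnx hny hxy, Ne.symm hnx])
    · exact c1 _ (by simp [cyc_apply hnx hny hxy, Ne.symm hnx, Ne.symm hxy])
    · exact c1 _ (by simp [cyc_apply hnx hny hxy, Ne.symm hny, Ne.symm hxy, hny])
    · exact c2 _ (by simp [cyc_apply hny hnw hyw, Ne.symm hnw, Ne.symm hyw, hnw])

/-- If merging the first two entries leads to an inverse pair, then so does the original list. -/
theorem hasInversePair_of_merge {S : Finset α} (hS : 5 ≤ S.card) {n x y w : α}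
    (hnd : [n, x, y, w].Nodup) {R : List (Perm α)}
    (hl : ∀ g ∈ cyc n x y :: cyc n y w :: R, g.IsThreeCycle)
    (hsupp : ∀ g ∈ cyc n x y :: cyc n y w :: R, ∀ p, g p ≠ p → p ∈ S)
    (hconn : ConnectedOn S (cyc n x y :: cyc n y w :: R))
    (h : HasInversePair (cyc x y w :: R)) : HasInversePair (cyc n x y :: cyc n y w :: R) := by
  have hnd' := hnd
  simp only [List.nodup_cons, List.mem_cons, List.not_mem_nil, or_false, not_or, not_false_eq_true,
    List.nodup_nil, and_true] at hnd'
  obtain ⟨⟨hnx, hny, hnw⟩, ⟨hxy, hxw⟩, hyw⟩ := hnd'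
  have hc := cyc_mul_cyc hnx hny hnw hxy hxw hyw
  obtain ⟨u0, g, v0, hg⟩ := h
  -- Follow the merged entry through the braid; `p` is the conjugator it has accumulated.
  obtain ⟨u, v, p, hm, hbr⟩ := hg.exists_split (u := []) (v := R) (by rw [hc]; rfl)
  have hndp : [p n, p x, p y, p w].Nodup := hnd.map p.injective
  rw [hc, mul_cyc_mul_inv] at hm
  rw [List.nil_append, mul_cyc_mul_inv, mul_cyc_mul_inv] at hbr
  rw [List.append_eq_append_iff] at hm
  have triangle {u v : List (Perm α)} (h : BraidEquiv (cyc n x y :: cyc n y w :: R)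
      (u ++ cyc (p n) (p x) (p y) :: cyc (p n) (p y) (p w) :: cyc (p w) (p y) (p x) :: v)) :=
    hasInversePair_of_braidEquiv_triangle hS hl hsupp hconn hndp h
  -- If the merged entry is neither `g` nor `g⁻¹`, the inverse pair survives the splitting.
  -- Otherwise splitting it leaves a triangle.
  rcases hm with ⟨t, rfl, ht⟩ | ⟨t, rfl, ht⟩
  · match t, ht with
    | [], ht =>
      simp only [List.nil_append, List.cons.injEq] at ht
      obtain ⟨rfl, rfl⟩ := ht
      rw [inv_cyc] at hbr
      exact triangle hbr
    | [z], ht =>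
      simp only [List.cons_append, List.nil_append, List.cons.injEq] at ht
      obtain ⟨rfl, hz, rfl⟩ := ht
      have hgc : g = cyc (p w) (p y) (p x) := by rw [← inv_cyc, ← hz, inv_inv]
      -- Here the merged entry is `g⁻¹`. Its two factors move left past `g` and conjugate `g` by
      -- their product, leaving it unchanged.
      have h1 := ((BraidEquiv.move_block_left [g] [cyc (p n) (p x) (p y),
        cyc (p n) (p y) (p w)]).append u0 v0)
      have hp : [cyc (p n) (p x) (p y), cyc (p n) (p y) (p w)].prod = g⁻¹ := by
        rw [hz, List.prod_cons, List.prod_singleton, ← mul_cyc_mul_inv, ← mul_cyc_mul_inv,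
          ← mul_cyc_mul_inv, ← hc]
        group
      rw [hp] at h1
      refine triangle (u := u0) (v := v0) (hbr.trans ?_)
      rw [← hgc]
      simpa using h1
    | z :: z' :: t, ht =>
      simp only [List.cons_append, List.cons.injEq] at ht
      obtain ⟨rfl, rfl, rfl⟩ := ht
      exact ⟨u0, g, _, by simpa using hbr⟩
  · match t, ht with
    | [], ht =>
      simp only [List.nil_append, List.cons.injEq] at ht
      obtain ⟨rfl, rfl⟩ := ht
      rw [List.append_nil] at *
      rw [inv_cyc] at hbr
      exact triangle hbr
    | z :: t, ht =>
      simp only [List.cons_append, List.cons.injEq] at ht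
      obtain ⟨rfl, rfl⟩ := ht
      exact ⟨u ++ cyc (p n) (p x) (p y) :: cyc (p n) (p y) (p w) :: t, g, v0, by simpa using hbr⟩

theorem isThreeCycle_eq_or_eq_inv {x y w : α} (hxy : x ≠ y) (hxw : x ≠ w) (hyw : y ≠ w)
    {g : Perm α} (hg : g.IsThreeCycle) (h : ∀ p, g p ≠ p → p = x ∨ p = y ∨ p = w) :
    g = cyc x y w ∨ g = cyc w y x := by
  have hx : g x ≠ x := by
    intro hx
    have : g.support ⊆ {y, w} := fun p hp => by
      have hp := Perm.mem_support.1 hp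
      rcases h p hp with rfl | h
      · exact absurd hx hp
      · simpa using h
    have := Finset.card_le_card this
    rw [hg.card_support, Finset.card_pair hyw] at this
    omega
  obtain ⟨i, j, hxi, hxj, hij, rfl⟩ := exists_eq_cyc hg hx
  have hi := h i (by simp [cyc_apply hxi hxj hij, hxi.symm, hij.symm])
  have hj := h j (by simp [cyc_apply hxi hxj hij, hxj.symm, hij.symm, hxj])
  rcases hi.resolve_left hxi.symm with rfl | rfl <;> rcases hj.resolve_left hxj.symm with rfl | rfl
  · exact absurd rfl hij
  · exact .inl rfl
  · right
    rw [cyc_rotate hxi hxj hij]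
  · exact absurd rfl hij

/-- The case of five points, one of which is moved by exactly two entries. -/
theorem hasInversePair_of_card_eq_five {S : Finset α} (hS : S.card = 5) {n x y w : α}
    (hnd : [n, x, y, w].Nodup) {R : List (Perm α)}
    (hl : ∀ g ∈ cyc n x y :: cyc n y w :: R, g.IsThreeCycle)
    (hsupp : ∀ g ∈ cyc n x y :: cyc n y w :: R, ∀ p, g p ≠ p → p ∈ S)
    (hR : ∀ g ∈ R, g n = n)
    (hconn : ConnectedOn S (cyc n x y :: cyc n y w :: R))
    (hprod : (cyc n x y :: cyc n y w :: R).prod = 1) :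
    HasInversePair (cyc n x y :: cyc n y w :: R) := by
  by_contra hbad
  have hnd' := hnd
  simp only [List.nodup_cons, List.mem_cons, List.not_mem_nil, or_false, not_or, not_false_eq_true,
    List.nodup_nil, and_true] at hnd'
  obtain ⟨⟨hnx, hny, hnw⟩, ⟨hxy, hxw⟩, hyw⟩ := hnd'
  have hc := cyc_mul_cyc hnx hny hnw hxy hxw hyw
  have hT : ({n, x, y, w} : Finset α) ⊆ S := by
    intro p hp
    have c1 := hsupp (cyc n x y) (by simp)
    have c2 := hsupp (cyc n y w) (by simp)
    simp only [Finset.mem_insert, Finset.mem_singleton] at hp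
    rcases hp with rfl | rfl | rfl | rfl
    · exact c1 _ (by simp [cyc_apply hnx hny hxy, Ne.symm hnx])
    · exact c1 _ (by simp [cyc_apply hnx hny hxy, Ne.symm hnx, Ne.symm hxy])
    · exact c1 _ (by simp [cyc_apply hnx hny hxy, Ne.symm hny, Ne.symm hxy, hny])
    · exact c2 _ (by simp [cyc_apply hny hnw hyw, Ne.symm hnw, Ne.symm hyw, hnw])
  have hTc : ({n, x, y, w} : Finset α).card = 4 := by
    have := List.toFinset_card_of_nodup hnd
    simpa only [List.toFinset_cons, List.toFinset_nil, insert_empty_eq, List.length_cons,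
      List.length_nil] using this
  obtain ⟨q, hqS, hqT⟩ := Finset.exists_mem_notMem_of_card_lt_card (hTc.trans_lt (by omega : 4 < S.card))
  have hSeq : insert q {n, x, y, w} = S := by
    apply Finset.eq_of_subset_of_card_le
    · exact Finset.insert_subset hqS hT
    · rw [Finset.card_insert_of_notMem hqT, hTc, hS]
  simp only [Finset.mem_insert, Finset.mem_singleton, not_or] at hqT
  obtain ⟨hqn, hqx, hqy, hqw⟩ := hqT
  have hf : Function.Injective ![n, x, y, w, q] := List.nodup_ofFn.1 (by simp; tauto)
  -- The block analysis at the fifth point `q` involves only `R`, whose entries fix `n`; a second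
  -- pair therefore lives on `{x, y, w, q}`.
  obtain ⟨L, R', hLR, hL, hR', hcase⟩ := exists_block (l := R) (fun g hg => hl g (by simp [hg]))
    (fun h => hbad (by simpa using h.append [cyc n x y, cyc n y w] [])) q
  have hbr : BraidEquiv (cyc n x y :: cyc n y w :: R) ([cyc n x y, cyc n y w] ++ (L ++ R')) :=
    hLR.append_left [cyc n x y, cyc n y w]
  have hcyc := hbr.forall_isThreeCycle hl
  have hmem : ∀ g ∈ L ++ R', ∀ p, g p ≠ p → p = x ∨ p = y ∨ p = w ∨ p = q := by
    intro g hg p hp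
    have h1 := hbr.forall_moved_mem hsupp g (List.mem_append_right _ hg) p hp
    have h2 : g n = n := hLR.forall_mem_subgroup (MulAction.stabilizer (Perm α) n) hR g hg
    have h3 : p ≠ n := by rintro rfl; exact hp h2
    rw [← hSeq] at h1
    simp only [Finset.mem_insert, Finset.mem_singleton] at h1
    tauto
  have hp2 := hbr.prod_eq.symm.trans hprod
  simp only [List.prod_append, List.prod_cons, List.prod_nil, mul_one, hc] at hp2
  rcases hcase with ⟨d, k, rfl⟩ | ⟨p, p', p'', hpnd, rfl⟩
  · obtain ⟨d', hd', t, ht, hdt⟩ := (hconn.of_braidEquiv hbr).exists_crossing hcyc (T := {q})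
      (by simpa using hqS) (by simp) (by simp; omega)
    rw [Finset.mem_singleton] at ht
    subst ht
    have hd'L : d' ∈ List.replicate k d := by
      have hne : d' t ≠ t := fun h => hdt (by simp [h])
      simp only [List.mem_append, List.mem_cons, List.not_mem_nil, or_false] at hd'
      rcases hd' with (rfl | rfl) | h | h
      · simp [cyc_apply hnx hny hxy, hqn, hqx, hqy] at hne
      · simp [cyc_apply hny hnw hyw, hqn, hqy, hqw] at hne
      · exact h
      · exact absurd (hR' _ h) hne
    obtain ⟨hk0, rfl⟩ := List.mem_replicate.1 hd'L
    have hdt := hcyc d' (by simp only [List.mem_append]; tauto)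
    -- The other factors of the total product fix `q`, hence so does `d' ^ k`.
    have hk : 3 ∣ k := by
      refine three_dvd_of_pow_apply_eq hdt (hL d' hd'L) ?_
      have e : d' ^ k = (cyc x y w)⁻¹ * R'.prod⁻¹ := by
        rw [List.prod_replicate] at hp2
        rw [eq_mul_inv_iff_mul_eq]
        exact eq_inv_of_mul_eq_one_right hp2
      rw [e, Perm.mul_apply, Perm.inv_eq_iff_eq, Perm.inv_eq_iff_eq.2 (list_prod_apply_eq hR').symm]
      simp [cyc_apply hxy hxw hyw, hqx, hqy, hqw]
    obtain ⟨j, rfl⟩ : ∃ j, k = 3 + j := ⟨k - 3, by obtain ⟨i, rfl⟩ := hk; omega⟩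
    have h3 := (BraidEquiv.swap_of_prod_eq_one [cyc n x y, cyc n y w] [d', d', d']
      (by simpa [mul_assoc] using mul_self_mul_self_of_isThreeCycle hdt)).append_right
      (List.replicate j d' ++ R')
    refine hbad (hasInversePair_of_braidEquiv_cube hS.ge hl hsupp hconn (a := d')
      (R := [cyc n x y, cyc n y w] ++ (List.replicate j d' ++ R')) (hbr.trans ?_))
    rw [List.replicate_add]
    simpa [List.replicate] using h3
  · simp only [List.nodup_cons, List.mem_cons, List.not_mem_nil, or_false, not_or,
      not_false_eq_true, List.nodup_nil, and_true] at hpnd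
    obtain ⟨⟨hqp, hqp', hqp''⟩, ⟨hpp', hpp''⟩, hp'p''⟩ := hpnd
    have m1 := hmem (cyc q p p') (by simp) p
      (by simp [cyc_apply hqp hqp' hpp', Ne.symm hqp, Ne.symm hpp'])
    have m2 := hmem (cyc q p p') (by simp) p'
      (by simp [cyc_apply hqp hqp' hpp', Ne.symm hqp', Ne.symm hpp', hqp'])
    have m3 := hmem (cyc q p' p'') (by simp) p''
      (by simp [cyc_apply hqp' hqp'' hp'p'', Ne.symm hqp'', Ne.symm hp'p'', hqp''])
    have same {i j : Fin 5} (h : i = 2 ∧ j = 1 ∨ i = 3 ∧ j = 2 ∨ i = 1 ∧ j = 3)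
        (hi : p = ![n, x, y, w, q] i) (hj : p' = ![n, x, y, w, q] j) : False := by
      have := hasInversePair_same_sign hf h
      rw [← hi, ← hj] at this
      refine hbad (HasInversePair.of_braidEquiv hbr ?_)
      simpa using this.append [] (cyc q p' p'' :: R')
    -- With opposite orientations excluded, `(p, p', p'')` is a rotation of `(x, y, w)`.
    obtain ⟨i, j, s, hijs, hi, hj, hs⟩ : ∃ i j s : Fin 5,
        (i = 1 ∧ j = 2 ∧ s = 3 ∨ i = 2 ∧ j = 3 ∧ s = 1 ∨ i = 3 ∧ j = 1 ∧ s = 2) ∧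
        p = ![n, x, y, w, q] i ∧ p' = ![n, x, y, w, q] j ∧ p'' = ![n, x, y, w, q] s := by
      have n1 : p ≠ q := Ne.symm hqp
      have n2 : p' ≠ q := Ne.symm hqp'
      have n3 : p'' ≠ q := Ne.symm hqp''
      have s1 : ¬ (p = y ∧ p' = x) := fun h => same (i := 2) (j := 1) (by simp) h.1 h.2
      have s2 : ¬ (p = w ∧ p' = y) := fun h => same (i := 3) (j := 2) (by simp) h.1 h.2
      have s3 : ¬ (p = x ∧ p' = w) := fun h => same (i := 1) (j := 3) (by simp) h.1 h.2
      rcases m1 with rfl | rfl | rfl | rfl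
      · have : p' = y := by grind
        exact ⟨1, 2, 3, by simp, rfl, this, (by grind : p'' = w)⟩
      · have : p' = w := by grind
        exact ⟨2, 3, 1, by simp, rfl, this, (by grind : p'' = x)⟩
      · have : p' = x := by grind
        exact ⟨3, 1, 2, by simp, rfl, this, (by grind : p'' = y)⟩
      · exact absurd rfl n1
    have hdd : cyc q p p' * cyc q p' p'' = cyc x y w := by
      rw [cyc_mul_cyc hqp hqp' hqp'' hpp' hpp'' hp'p'', hi, hj, hs]
      rcases hijs with ⟨rfl, rfl, rfl⟩ | ⟨rfl, rfl, rfl⟩ | ⟨rfl, rfl, rfl⟩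
      · rfl
      · exact (cyc_rotate hxy hxw hyw).symm
      · exact cyc_rotate (Ne.symm hxw) (Ne.symm hyw) hxy
    -- Both pairs have product `(x y w)`, whose square is not one, so `R'` is nonempty. Its first
    -- entry moves only `x, y, w`: it is `(x y w)`, giving the two-pair configuration, or the
    -- inverse, completing a triangle.
    match R', hbr, hcyc, hR', hmem, hp2 with
    | [], _, _, _, _, hp2 =>
      simp only [List.prod_cons, List.prod_nil, mul_one, hdd] at hp2
      have := congrArg (fun g : Perm α => g x) hp2
      simp [cyc_apply hxy hxw hyw, Ne.symm hxy, Ne.symm hxw] at this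
    | g :: R', hbr, hcyc, hR', hmem, _ =>
      have hgq : g q = q := hR' g (by simp)
      rcases isThreeCycle_eq_or_eq_inv hxy hxw hyw (hcyc g (by simp)) (fun t ht => by
        have := hmem g (by simp) t ht
        have h' : t ≠ q := by rintro rfl; exact ht hgq
        rcases this with h | h | h | h
        exacts [.inl h, .inr (.inl h), .inr (.inr h), absurd h h']) with rfl | rfl
      · have := hasInversePair_two_pairs hf hijs
        rw [← hi, ← hj, ← hs] at this
        refine hbad (HasInversePair.of_braidEquiv hbr ?_)
        simpa using this.append [] R'
      · refine hbad (hasInversePair_of_braidEquiv_triangle hS.ge hl hsupp hconn hnd (u := [])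
          (v := [cyc q p p', cyc q p' p''].map (fun t => (cyc w y x)⁻¹ * t * cyc w y x) ++ R')
          (hbr.trans ?_))
        have := (BraidEquiv.move_left [cyc q p p', cyc q p' p''] (cyc w y x)).append
          [cyc n x y, cyc n y w] R'
        simpa using this

omit [Fintype α] in
/-- Merging two 3-cycles keeps a list of permutations connected away from the point `n`. -/
theorem ConnectedOn.merge {S : Finset α} {n x y w : α} (hnd : [n, x, y, w].Nodup) (hnS : n ∈ S)
    {R : List (Perm α)} (hR : ∀ g ∈ R, g n = n)
    (hcon : ConnectedOn S ([cyc n x y, cyc n y w] ++ R)) :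
    ConnectedOn (S.erase n) (cyc x y w :: R) := by
  simp only [List.nodup_cons, List.mem_cons, List.not_mem_nil, or_false, not_or,
    not_false_eq_true, List.nodup_nil, and_true] at hnd
  obtain ⟨⟨hnx, hny, hnw⟩, ⟨hxy, hxw⟩, hyw⟩ := hnd
  intro T hT hne hinv
  have hnT : n ∉ T := fun h => Finset.notMem_erase n S (hT h)
  have hTS : T ⊆ S := hT.trans (Finset.erase_subset _ _)
  have hcT := hinv (cyc x y w) (by simp)
  have hTx : y ∈ T ↔ x ∈ T := by simpa [cyc_apply hxy hxw hyw] using hcT x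
  have hTy : w ∈ T ↔ y ∈ T := by
    simpa [cyc_apply hxy hxw hyw, Ne.symm hxy] using hcT y
  -- Invariance puts all or none of `x, y, w` in `T`. In the first case `insert n T` is invariant
  -- for the unmerged list, in the second `T` itself is.
  by_cases hx : x ∈ T
  · have hy := hTx.2 hx
    have hw := hTy.2 hy
    have := hcon (insert n T) (Finset.insert_subset hnS hTS) (by simp) (by
      intro g hg
      simp only [List.cons_append, List.nil_append, List.mem_cons] at hg
      rcases hg with rfl | rfl | hg
      · refine apply_mem_iff_of_moved_mem fun p hp => ?_
        rw [cyc_apply hnx hny hxy] at hp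
        split_ifs at hp with e1 e2 e3 <;> simp_all
      · refine apply_mem_iff_of_moved_mem fun p hp => ?_
        rw [cyc_apply hny hnw hyw] at hp
        split_ifs at hp with e1 e2 e3 <;> simp_all
      · intro p
        have h1 := hinv g (by simp [hg]) p
        have h2 : g p = n ↔ p = n :=
          ⟨fun h => g.injective (h.trans (hR g hg).symm), fun h => h ▸ hR g hg⟩
        rw [Finset.mem_insert, Finset.mem_insert, h1, h2])
    rw [← this, Finset.erase_insert hnT]
  · have hy : y ∉ T := fun h => hx (hTx.1 h)
    have hw : w ∉ T := fun h => hy (hTy.1 h)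
    have := hcon T hTS hne (by
      intro g hg
      simp only [List.cons_append, List.nil_append, List.mem_cons] at hg
      rcases hg with rfl | rfl | hg
      · refine apply_mem_iff_of_fixed fun p hp => ?_
        rw [cyc_apply hnx hny hxy]
        split_ifs with e1 e2 e3 <;> simp_all
      · refine apply_mem_iff_of_fixed fun p hp => ?_
        rw [cyc_apply hny hnw hyw]
        split_ifs with e1 e2 e3 <;> simp_all
      · exact hinv g (by simp [hg]))
    exact absurd (this ▸ hnS) hnT

theorem hasInversePair_of_connectedOn (S : Finset α) (hS : 5 ≤ S.card) (l : List (Perm α))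
    (hl : ∀ g ∈ l, g.IsThreeCycle) (hsupp : ∀ g ∈ l, ∀ p, g p ≠ p → p ∈ S)
    (hconn : ConnectedOn S l) (hprod : l.prod = 1) : HasInversePair l := by
  induction S using Finset.strongInduction generalizing l with
  | H S ih =>
  by_contra hbad
  obtain ⟨n, hnS⟩ : S.Nonempty := Finset.card_pos.1 (by omega)
  obtain ⟨L, R, hbr, hL, hR, hcase⟩ := exists_block hl hbad n
  have hcyc := hbr.forall_isThreeCycle hl
  have hmov := hbr.forall_moved_mem hsupp
  have hcon := hconn.of_braidEquiv hbr
  have hp := hbr.prod_eq.symm.trans hprod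
  rcases hcase with ⟨a, k, rfl⟩ | ⟨x, y, w, hnd, rfl⟩
  · obtain ⟨d, hd, t, ht, hdt⟩ := hcon.exists_crossing hcyc (T := {n})
      (by simpa using hnS) (by simp) (by simp; omega)
    rw [Finset.mem_singleton] at ht
    subst ht
    have hdL : d ∈ List.replicate k a := by
      have hne : d t ≠ t := fun h => hdt (by simp [h])
      exact (List.mem_append.1 hd).resolve_right fun h => hne (hR _ h)
    obtain ⟨hk0, rfl⟩ := List.mem_replicate.1 hdL
    -- The remaining entries fix the chosen point, so the product relation makes `d ^ k` fix it too;
    -- `k` is nonzero because `d` occurs.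
    have hk : 3 ∣ k := by
      refine three_dvd_of_pow_apply_eq (hcyc d hd) (hL d hdL) ?_
      rw [List.prod_append, List.prod_replicate] at hp
      rw [eq_inv_of_mul_eq_one_left hp, Perm.inv_eq_iff_eq, list_prod_apply_eq hR]
    obtain ⟨j, rfl⟩ : ∃ j, k = 3 + j := ⟨k - 3, by obtain ⟨i, rfl⟩ := hk; omega⟩
    refine hbad (hasInversePair_of_braidEquiv_cube hS hl hsupp hconn (a := d)
      (R := List.replicate j d ++ R) ?_)
    rw [List.replicate_add] at hbr
    simpa [List.replicate] using hbr
  · refine hbad (HasInversePair.of_braidEquiv hbr ?_)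
    -- Merging discards one point, so the induction hypothesis needs at least six points here.
    rcases Nat.lt_or_ge 5 S.card with h6 | h5
    swap
    · exact hasInversePair_of_card_eq_five (le_antisymm h5 hS) hnd hcyc hmov hR hcon hp
    have hnd' := hnd
    simp only [List.nodup_cons, List.mem_cons, List.not_mem_nil, or_false, not_or,
      not_false_eq_true, List.nodup_nil, and_true] at hnd'
    obtain ⟨⟨hnx, hny, hnw⟩, ⟨hxy, hxw⟩, hyw⟩ := hnd'
    have hc := cyc_mul_cyc hnx hny hnw hxy hxw hyw
    have c1 := hmov (cyc n x y) (by simp)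
    have c2 := hmov (cyc n y w) (by simp)
    have hxS : x ∈ S := c1 _ (by simp [cyc_apply hnx hny hxy, Ne.symm hnx, Ne.symm hxy])
    have hyS : y ∈ S := c1 _ (by simp [cyc_apply hnx hny hxy, Ne.symm hny, Ne.symm hxy, hny])
    have hwS : w ∈ S := c2 _ (by simp [cyc_apply hny hnw hyw, Ne.symm hnw, Ne.symm hyw, hnw])
    have hcmoved : ∀ p, cyc x y w p ≠ p → p = x ∨ p = y ∨ p = w := by
      intro p hp
      rw [cyc_apply hxy hxw hyw] at hp
      split_ifs at hp <;> tauto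
    refine hasInversePair_of_merge hS hnd hcyc hmov hcon
      (ih (S.erase n) (Finset.erase_ssubset hnS) (by rw [Finset.card_erase_of_mem hnS]; omega)
        _ ?_ ?_ ?_ ?_)
    · intro g hg
      rcases List.mem_cons.1 hg with rfl | hg
      · exact isThreeCycle_cyc hxy hxw hyw
      · exact hcyc g (List.mem_append_right _ hg)
    · intro g hg p hp
      rw [Finset.mem_erase]
      rcases List.mem_cons.1 hg with rfl | hg
      · rcases hcmoved p hp with rfl | rfl | rfl
        exacts [⟨Ne.symm hnx, hxS⟩, ⟨Ne.symm hny, hyS⟩, ⟨Ne.symm hnw, hwS⟩]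
      · exact ⟨fun h => hp (h ▸ hR g hg), hmov g (List.mem_append_right _ hg) p hp⟩
    · exact hcon.merge hnd hnS (fun g hg => hR g hg)
    · rw [List.prod_append, List.prod_cons, List.prod_singleton, hc] at hp
      exact hp

end Main

/-! ### From generators of the alternating group to the theorem -/

theorem connectedOn_univ_of_closure_eq_top {n : ℕ} (hn : 5 ≤ n) {ι : Type*}
    (g : ι → alternatingGroup (Fin n)) (hg : Subgroup.closure (Set.range g) = ⊤)
    {l : List (Equiv.Perm (Fin n))} (hl : ∀ i, (g i : Equiv.Perm (Fin n)) ∈ l) :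
    ConnectedOn Finset.univ l := by
  intro T _ hne hT
  let H : Subgroup (alternatingGroup (Fin n)) :=
    { carrier := {a | ∀ x, (a : Equiv.Perm (Fin n)) x ∈ T ↔ x ∈ T}
      mul_mem' := fun {a b} ha hb x => (ha ((b : Equiv.Perm (Fin n)) x)).trans (hb x)
      one_mem' := fun x => Iff.rfl
      inv_mem' := fun {a} ha x => by simpa using (ha ((a : Equiv.Perm (Fin n))⁻¹ x)).symm }
  have hH : H = ⊤ := by
    rw [eq_top_iff, ← hg, Subgroup.closure_le]
    rintro _ ⟨i, rfl⟩
    exact hT _ (hl i)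
  obtain ⟨x, hx⟩ := hne
  rw [Finset.eq_univ_iff_forall]
  intro y
  by_cases hxy : x = y
  · exact hxy ▸ hx
  -- A third point turns the passage from `x` to `y` into a 3-cycle, hence into an even permutation.
  obtain ⟨z, hz⟩ : ∃ z, z ∉ ({x, y} : Finset (Fin n)) := by
    by_contra! h
    have := Finset.card_le_two (a := x) (b := y)
    rw [Finset.eq_univ_iff_forall.2 h, Finset.card_univ, Fintype.card_fin] at this
    omega
  simp only [Finset.mem_insert, Finset.mem_singleton, not_or] at hz
  have h3 := isThreeCycle_cyc hxy (Ne.symm hz.1) (Ne.symm hz.2)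
  have hmem : (⟨cyc x y z, h3.mem_alternatingGroup⟩ : alternatingGroup (Fin n)) ∈ H :=
    hH ▸ Subgroup.mem_top _
  have := (hmem x).2 hx
  simpa [cyc_apply hxy (Ne.symm hz.1) (Ne.symm hz.2)] using this

theorem mainTheorem7 (n r : ℕ) (hn : 5 ≤ n) (hr : 4 ≤ r)
    (g : Fin r → alternatingGroup (Fin n))
    (hg : g ∈ nielsenClass (alternatingGroup (Fin n)) (fun _ : Fin r => threeCycleClass n)) :
    ∃ Q : BraidGroup r,
      IsInversePair (braidAct g Q ⟨0, by omega⟩) (braidAct g Q ⟨1, by omega⟩) := by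
  obtain ⟨hprod, ⟨σ, hσ⟩, hgen⟩ := hg
  have h3 : ∀ a ∈ List.ofFn (fun i => (g i : Equiv.Perm (Fin n))), a.IsThreeCycle := by
    intro a ha
    obtain ⟨i, rfl⟩ := List.mem_ofFn.1 ha
    exact hσ i
  have hgood : HasInversePair (List.ofFn (fun i => (g i : Equiv.Perm (Fin n)))) := by
    refine hasInversePair_of_connectedOn Finset.univ (by simpa using hn) _ h3 (by simp) ?_ ?_
    · exact connectedOn_univ_of_closure_eq_top hn g hgen fun i => List.mem_ofFn.2 ⟨i, rfl⟩
    · have := congrArg (alternatingGroup (Fin n)).subtype hprod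
      rwa [map_list_prod, List.map_ofFn, map_one] at this
  obtain ⟨c, v, hc⟩ := hgood.exists_front
  -- The braiding took place among permutations; the inclusion of the alternating group carries it
  -- back to the original tuple.
  obtain ⟨Q, hQ⟩ := hc.exists_braidAct (alternatingGroup (Fin n)).subtype g rfl
  refine ⟨Q, ?_⟩
  have hc3 := hc.forall_isThreeCycle h3 c (by simp)
  have hlen := congrArg List.length hQ
  have e (j : ℕ) (hj : j < r) : ((braidAct g Q ⟨j, hj⟩ : alternatingGroup (Fin n)) : Equiv.Perm (Fin n)) =
      (c :: c⁻¹ :: v)[j]'(by rw [hlen]; simpa using hj) := by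
    simp only [hQ]; simp
  have e0 := e 0 (by omega)
  have e1 := e 1 (by omega)
  simp only [List.getElem_cons_zero, List.getElem_cons_succ] at e0 e1
  constructor
  · change Equiv.Perm.IsThreeCycle _
    rw [e0]
    exact hc3
  · apply Subtype.ext
    rw [e1, Subgroup.coe_inv, e0]
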